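/- Let $\mathbb H^3$ be hyperbolic 3-space (curvature $-1$), with distance $\operatorname{dist}$ and Riemannian volume $\operatorname{vol}$. For $r>0$ and $w\in\mathbb R$ let $\kappa(r,w)$ be the volume of the intersection of a closed ball of radius $r$ in $\mathbb H^3$ with a closed half-space whose bounding plane lies at distance $|w|$ from the centre of the ball, and which contains the centre if $w\le 0$ and does not contain it if $w>0$. Put $B(a)=\pi(\sinh 2a-2a)$ for $a>0$. For $x,y,z>0$ put $$\eta(x,y,z)=\frac{2\cosh x\cosh y\cosh z-(\cosh^2x+\cosh^2y+\cosh^2z)+1}{\sinh^2z},$$ $$\mathcal V=\{(x,y,z)\in(0,\infty)^3:\eta(x,y,z)\ge0\},\qquad \mathcal V_0=\{(\rho,r,D)\in\mathcal V: r<D\}.$$ For $(x,y,z)\in\mathcal V$ put $$\sigma(x,y,z)=\operatorname{arccosh}\frac{\cosh x}{\sqrt{1+\eta(x,y,z)}},\qquad V_{\rm lens}(x,y,z)=\kappa(x,\sigma(x,y,z))+\kappa(y,z-\sigma(x,y,z)).$$ For $a>0$ and $\beta\in\mathbb R$ put $$\psi(a,\beta)=\operatorname{arccosh}\frac{\cosh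 a}{\sqrt{1+\sinh^2a\,\sin^2\beta}},\qquad V_{\rm cone}(a,\beta)=\frac{B(a)}2(1-\cos\beta)-\kappa(a,\psi(a,\beta)).$$ For $0<r<D$ put $$\omega(r,D)=\operatorname{arccosh}\frac{\cosh D}{\cosh r},\qquad \theta(r,D)=\arcsin\frac{\sinh r}{\sinh D}.$$ Finally, for $(\rho,r,D)\in\mathcal V_0$ put $$\phi(\rho,r,D)=V_{\rm lens}(\rho,r,D)+V_{\rm cone}(\omega(r,D),\theta(r,D))-\kappa\bigl(r,D-\psi(\omega(r,D),\theta(r,D))\bigr).$$ **Lemma.** Let $T$ and $Q$ be distinct points of $\mathbb H^3$, and set $D=\operatorname{dist}(T,Q)$. Let $\rho$ and $r$ be positive numbers such that $r<D<\rho<D+r$. Then $(\rho,r,D)\in\mathcal V_0$. Furthermore, if $Z\subset\mathbb H^3$ denotes the convex hull of the union of $\{T\}$ with the closed ball of radius $r$ about $Q$, and $N$ denotes the closed ball of radius $\rho$ about $T$, then $$\operatorname{vol}(Z\cap N)=\phi(\rho,r,D).$$ -/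

import Mathlib

noncomputable section

namespace HypThree

/-- Euclidean three-space, the spatial part of Minkowski space. -/
abbrev E3 : Type := EuclideanSpace ℝ (Fin 3)

/-- The Lorentz form on Minkowski space `ℝ × ℝ³` (first coordinate: time). -/
def lorentz (p q : ℝ × E3) : ℝ := inner ℝ p.2 q.2 - p.1 * q.1

/-- Hyperbolic three-space (curvature `-1`): the upper sheet of the hyperboloid
`⟨p, p⟩ = -1` in Minkowski space. -/
def H3 : Type := {p : ℝ × E3 // lorentz p p = -1 ∧ 0 < p.1}

instance : MeasurableSpace H3 :=
  inferInstanceAs (MeasurableSpace {p : ℝ × E3 // lorentz p p = -1 ∧ 0 < p.1})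

/-- The hyperbolic distance: `cosh (hdist p q) = -⟨p, q⟩`. -/
def hdist (p q : H3) : ℝ := Real.arcosh (-lorentz p.1 q.1)

/-- The closed ball of radius `r` about `c`. -/
def hclosedBall (c : H3) (r : ℝ) : Set H3 := {p | hdist p c ≤ r}

/-- The geodesic segment with endpoints `p` and `q`, as the set of points metrically
between them. -/
def hsegment (p q : H3) : Set H3 := {z | hdist p z + hdist z q = hdist p q}

/-- A set is convex if it contains the geodesic segment joining any two of its points. -/
def HConvex (S : Set H3) : Prop := ∀ p ∈ S, ∀ q ∈ S, hsegment p q ⊆ S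

/-- The convex hull: the smallest convex set containing `S`. -/
def hconvexHull (S : Set H3) : Set H3 := ⋂₀ {C | HConvex C ∧ S ⊆ C}

/-- The global parametrization of `H3` by `ℝ³`, the inverse of the projection to the
spatial part. -/
def lift (x : E3) : H3 :=
  ⟨(√(1 + ‖x‖ ^ 2), x), by
    have h : 0 < 1 + ‖x‖ ^ 2 := by positivity
    refine ⟨?_, Real.sqrt_pos.2 h⟩
    simp only [lorentz, real_inner_self_eq_norm_sq, Real.mul_self_sqrt h.le]
    ring⟩

/-- The map `lift` is measurable, so that pushing a measure forward along it is meaningful. -/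
theorem measurable_lift : Measurable lift := by
  refine Measurable.subtype_mk ?_
  fun_prop

/-- The `i`-th coordinate tangent vector `∂ lift / ∂ xᵢ` at `lift x`. -/
def tangentVec (x : E3) (i : Fin 3) : ℝ × E3 :=
  (x i / √(1 + ‖x‖ ^ 2), EuclideanSpace.single i 1)

/-- The Riemannian metric tensor of `H3` in the global chart inverse to `lift`: the Lorentz
form restricted to the tangent spaces of the hyperboloid. -/
def metricTensor (x : E3) : Matrix (Fin 3) (Fin 3) ℝ :=
  Matrix.of fun i j => lorentz (tangentVec x i) (tangentVec x j)

/-- The Riemannian volume measure of `H3`: in the chart it is `√(det g) dx`. -/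
def hvol : MeasureTheory.Measure H3 :=
  ((MeasureTheory.volume : MeasureTheory.Measure E3).withDensity
    fun x => ENNReal.ofReal √(metricTensor x).det).map lift

/-- A base point of `H3`, the point `(1, 0)` of the hyperboloid. -/
def origin : H3 := lift 0

/-- The closed half-space of `H3` with Lorentz-unit inner normal `(sinh w, (cosh w, 0, 0))`.
Its bounding plane is perpendicular to the first coordinate axis through `origin` and meets it
at signed distance `w` from `origin`, so `origin` has distance `|w|` from the plane;
the half-space contains `origin` if and only if `w ≤ 0`. -/
def halfSpace (w : ℝ) : Set H3 :=
  {p | 0 ≤ lorentz p.1 (Real.sinh w, EuclideanSpace.single 0 (Real.cosh w))}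

/-- `κ(r, w)`: the volume of the intersection of a closed ball of radius `r` with a closed
half-space whose bounding plane has distance `|w|` from the centre of the ball, and which
contains the centre if `w ≤ 0` and does not contain it if `w > 0`. (Isometries of `H3` act
transitively on such configurations, and the ball is placed at `origin`.) -/
def kappa (r w : ℝ) : ℝ := (hvol (hclosedBall origin r ∩ halfSpace w)).toReal

/-- `B(r) = π (sinh 2r - 2r)`. -/
def ballVol (r : ℝ) : ℝ := Real.pi * (Real.sinh (2 * r) - 2 * r)

def eta (x y z : ℝ) : ℝ :=
  (2 * Real.cosh x * Real.cosh y * Real.cosh z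
    - (Real.cosh x ^ 2 + Real.cosh y ^ 2 + Real.cosh z ^ 2) + 1) / Real.sinh z ^ 2

/-- The set `𝒱`. -/
def setV : Set (ℝ × ℝ × ℝ) :=
  {v | 0 < v.1 ∧ 0 < v.2.1 ∧ 0 < v.2.2 ∧ 0 ≤ eta v.1 v.2.1 v.2.2}

/-- The set `𝒱₀`, of triples `(ρ, r, D)` in `𝒱` with `r < D`. -/
def setVZero : Set (ℝ × ℝ × ℝ) := {v | v ∈ setV ∧ v.2.1 < v.2.2}

/-- The function `σ`, used on `𝒱`. -/
def sigma (x y z : ℝ) : ℝ := Real.arcosh (Real.cosh x / √(1 + eta x y z))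

/-- The function `V_lens`, used on `𝒱`. -/
def lensVol (x y z : ℝ) : ℝ := kappa x (sigma x y z) + kappa y (z - sigma x y z)

/-- The function `ψ`, used for `a > 0`. -/
def psi (a β : ℝ) : ℝ :=
  Real.arcosh (Real.cosh a / √(1 + Real.sinh a ^ 2 * Real.sin β ^ 2))

/-- The function `V_cone`, used for `a > 0`. -/
def coneVol (a β : ℝ) : ℝ := ballVol a / 2 * (1 - Real.cos β) - kappa a (psi a β)

/-- The function `ω`, used for `0 < r < D`. -/
def omega (r D : ℝ) : ℝ := Real.arcosh (Real.cosh D / Real.cosh r)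

/-- The function `θ`, used for `0 < r < D`. -/
def theta (r D : ℝ) : ℝ := Real.arcsin (Real.sinh r / Real.sinh D)

/-- The function `φ`, used on `𝒱₀`. -/
def phi (ρ r D : ℝ) : ℝ :=
  lensVol ρ r D + coneVol (omega r D) (theta r D)
    - kappa r (D - psi (omega r D) (theta r D))

end HypThree

end

/-!
The hull `Z` is the union of the ball about `Q` with the tangent cone from `T` truncated by the plane
through the circle of tangency (`mem_hconvexHull_iff_cone`). Indeed segments are nonnegative linear
combinations in the hyperboloid model (`mem_hsegment_iff`), so `z` lies in `Z` exactly when the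
backward ray `z - α T`, `0 ≤ α`, meets the linear cone over the ball; this is a question about the
sign of a quadratic polynomial in `α`, whose vertex is governed by the polar plane of `T`. As
`cosh ω = cosh D / cosh r`, the truncated cone lies in the ball of radius `ω < ρ` about `T`, hence in
`N`, and inclusion-exclusion gives

`vol (Z ∩ N) = vol (ball ∩ N) + vol (truncated cone) - vol (ball ∩ truncated cone)`.

* The lens `ball ∩ N` is cut by the radical plane, at distance `σ` from `T`, into two caps
  (`hvol_lens`).
* The truncated cone is a sector of the ball of radius `ω` about `T` minus the cap beyond the plane of
  the circle of tangency, at distance `ψ` from `T` (`hvol_truncatedCone`).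
* Since the ball lies in its tangent cone, `ball ∩ truncated cone` is the cap of the ball on the side
  of `T` of that plane (`hclosedBall_inter_truncatedCone`).

All sets involved are described by the two numbers `⟨z, T⟩` and `⟨z, e⟩`, where `e` is the unit
direction from `T` to `Q`. A cap has volume `κ` wherever it lies (`hvol_hclosedBall_inter_halfSpace`)
and a plane is null (`hvol_plane`) because Lorentz reflections preserve the volume
(`measurePreserving_reflH3`, from the transformation of the Gram determinant) and act transitively
(`exists_isometry`). The volume of a sector (`hvol_sector`) comes from the volume of a Euclidean sector
and the homogeneity of cones.
-/

noncomputable section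

namespace HypThree

open Real

/-! ### The Lorentz form -/

lemma lorentz_comm (p q : ℝ × E3) : lorentz p q = lorentz q p := by
  simp only [lorentz, real_inner_comm, mul_comm]

lemma lorentz_add_left (p q x : ℝ × E3) : lorentz (p + q) x = lorentz p x + lorentz q x := by
  simp only [lorentz, Prod.fst_add, Prod.snd_add, inner_add_left]; ring

lemma lorentz_smul_left (α : ℝ) (p x : ℝ × E3) : lorentz (α • p) x = α * lorentz p x := by
  simp only [lorentz, Prod.smul_fst, Prod.smul_snd, real_inner_smul_left, smul_eq_mul]; ring

lemma lorentz_sub_left (p q x : ℝ × E3) : lorentz (p - q) x = lorentz p x - lorentz q x := by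
  simp only [lorentz, Prod.fst_sub, Prod.snd_sub, inner_sub_left]; ring

lemma lorentz_neg_left (p x : ℝ × E3) : lorentz (-p) x = -lorentz p x := by
  simp only [lorentz, Prod.fst_neg, Prod.snd_neg, inner_neg_left]; ring

lemma lorentz_add_right (p q x : ℝ × E3) : lorentz x (p + q) = lorentz x p + lorentz x q := by
  simp only [lorentz_comm x, lorentz_add_left]

lemma lorentz_smul_right (α : ℝ) (p x : ℝ × E3) : lorentz x (α • p) = α * lorentz x p := by
  simp only [lorentz_comm x, lorentz_smul_left]

lemma lorentz_sub_right (p q x : ℝ × E3) : lorentz x (p - q) = lorentz x p - lorentz x q := by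
  simp only [lorentz_comm x, lorentz_sub_left]

lemma lorentz_neg_right (p x : ℝ × E3) : lorentz x (-p) = -lorentz x p := by
  simp only [lorentz_comm x, lorentz_neg_left]

lemma lorentz_self (p : ℝ × E3) : lorentz p p = ‖p.2‖ ^ 2 - p.1 ^ 2 := by
  simp only [lorentz, real_inner_self_eq_norm_sq]; ring

lemma H3.lorentz_self (p : H3) : lorentz p.1 p.1 = -1 := p.2.1

lemma H3.fst_pos (p : H3) : 0 < p.1.1 := p.2.2

lemma H3.norm_sq (p : H3) : ‖p.1.2‖ ^ 2 = p.1.1 ^ 2 - 1 := by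
  have := p.lorentz_self
  rw [HypThree.lorentz_self] at this; linarith

/-- The orthogonal complement of a timelike vector is positive definite. -/
lemma lorentz_self_nonneg_of_orthogonal (p : H3) {u : ℝ × E3} (h : lorentz u p.1 = 0) :
    0 ≤ lorentz u u ∧ (lorentz u u = 0 → u = 0) := by
  have h1 : inner ℝ u.2 p.1.2 = u.1 * p.1.1 := by
    simp only [lorentz] at h; linarith
  have h2 : (u.1 * p.1.1) ^ 2 ≤ ‖u.2‖ ^ 2 * (p.1.1 ^ 2 - 1) := by
    rw [← p.norm_sq, ← h1, ← mul_pow]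
    exact sq_le_sq' (by linarith [neg_le_of_abs_le (abs_real_inner_le_norm u.2 p.1.2)])
      (real_inner_le_norm _ _)
  have hp := p.fst_pos
  have hp2 : 0 < p.1.1 ^ 2 := by positivity
  rw [lorentz_self]
  have key : ‖u.2‖ ^ 2 ≤ (‖u.2‖ ^ 2 - u.1 ^ 2) * p.1.1 ^ 2 := by nlinarith
  constructor
  · by_contra hc
    nlinarith [sq_nonneg ‖u.2‖]
  · intro h0
    rw [h0, zero_mul] at key
    have h3 : ‖u.2‖ ^ 2 = 0 := le_antisymm key (sq_nonneg _)
    have h4 : u.1 = 0 := by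
      have : u.1 ^ 2 = 0 := by linarith
      exact pow_eq_zero_iff (two_ne_zero) |>.1 this
    have h5 : u.2 = 0 := norm_eq_zero.1 (pow_eq_zero_iff (two_ne_zero) |>.1 h3)
    exact Prod.ext h4 h5

/-- A timelike vector is future-pointing exactly when its product with a point of the upper
sheet is negative. -/
lemma fst_pos_iff_lorentz_neg (p : H3) {x : ℝ × E3} (hx : lorentz x x < 0) :
    0 < x.1 ↔ lorentz x p.1 < 0 := by
  have hp := p.fst_pos
  rw [lorentz_self] at hx
  have h1 : ‖x.2‖ < |x.1| := by
    rw [← abs_of_nonneg (norm_nonneg x.2)]; exact sq_lt_sq.1 (by linarith)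
  have h2 : ‖p.1.2‖ < p.1.1 := by
    have := p.norm_sq
    exact lt_of_pow_lt_pow_left₀ 2 hp.le (by linarith)
  have h3 : |inner ℝ x.2 p.1.2| < |x.1| * p.1.1 :=
    (abs_real_inner_le_norm _ _).trans_lt
      (mul_lt_mul'' h1 h2 (norm_nonneg _) (norm_nonneg _))
  have h4 := abs_lt.1 h3
  simp only [lorentz]
  constructor
  · intro h
    rw [abs_of_pos h] at h4; linarith
  · intro h
    by_contra hc
    rw [abs_of_nonpos (not_lt.1 hc)] at h4; linarith

/-- Reverse Cauchy-Schwarz inequality on the upper sheet. -/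
lemma one_le_neg_lorentz (p q : H3) : 1 ≤ -lorentz p.1 q.1 := by
  have hneg : lorentz p.1 q.1 < 0 :=
    (fst_pos_iff_lorentz_neg q (by rw [p.lorentz_self]; norm_num)).1 p.fst_pos
  have h := (lorentz_self_nonneg_of_orthogonal q (u := p.1 + lorentz p.1 q.1 • q.1) (by
    rw [lorentz_add_left, lorentz_smul_left, q.lorentz_self]; ring)).1
  simp only [lorentz_add_left, lorentz_add_right, lorentz_smul_left, lorentz_smul_right,
    p.lorentz_self, q.lorentz_self, lorentz_comm q.1 p.1] at h
  nlinarith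

lemma eq_of_lorentz_eq_neg_one {p q : H3} (h : lorentz p.1 q.1 = -1) : p = q := by
  have h0 := (lorentz_self_nonneg_of_orthogonal q (u := p.1 - q.1) (by
    rw [lorentz_sub_left, q.lorentz_self, h]; ring)).2 (by
    simp only [lorentz_sub_left, lorentz_sub_right, p.lorentz_self, q.lorentz_self, h,
      lorentz_comm q.1 p.1]; ring)
  exact Subtype.ext (sub_eq_zero.1 h0)

/-- A timelike vector on the same side as `p` is a positive multiple of a point of `H3`. -/
lemma exists_eq_smul_of_timelike (p : H3) {x : ℝ × E3} (hx : lorentz x x < 0)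
    (hxp : lorentz x p.1 < 0) :
    ∃ (w : ℝ) (b : H3), 0 < w ∧ w ^ 2 = -lorentz x x ∧ x = w • b.1 := by
  have hw : 0 < √(-lorentz x x) := sqrt_pos.2 (by linarith)
  have hw2 : √(-lorentz x x) ^ 2 = -lorentz x x := sq_sqrt (by linarith)
  have hx1 := (fst_pos_iff_lorentz_neg p hx).2 hxp
  refine ⟨√(-lorentz x x), ⟨(√(-lorentz x x))⁻¹ • x, ?_, ?_⟩, hw, hw2, ?_⟩
  · rw [lorentz_smul_left, lorentz_smul_right]
    have : lorentz x x = -√(-lorentz x x) ^ 2 := by linarith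
    field_simp
    linarith
  · exact mul_pos (inv_pos.2 hw) hx1
  · simp only [smul_smul, mul_inv_cancel₀ hw.ne', one_smul]

/-! ### Distance, segments and convex hulls in the hyperboloid model -/

lemma cosh_hdist (p q : H3) : cosh (hdist p q) = -lorentz p.1 q.1 :=
  cosh_arcosh (one_le_neg_lorentz p q)

lemma hdist_nonneg (p q : H3) : 0 ≤ hdist p q := arcosh_nonneg (one_le_neg_lorentz p q)

lemma hdist_le_iff (p q : H3) {r : ℝ} (hr : 0 ≤ r) :
    hdist p q ≤ r ↔ -lorentz p.1 q.1 ≤ cosh r := by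
  rw [← cosh_hdist, cosh_le_cosh, abs_of_nonneg (hdist_nonneg p q), abs_of_nonneg hr]

lemma mem_hclosedBall_iff (p q : H3) {r : ℝ} (hr : 0 ≤ r) :
    p ∈ hclosedBall q r ↔ -lorentz p.1 q.1 ≤ cosh r := hdist_le_iff p q hr

lemma sinh_hdist_of_combination {p q z : H3} {α β : ℝ} (hβ : 0 ≤ β)
    (hz : z.1 = α • p.1 + β • q.1) : sinh (hdist p z) = β * sinh (hdist p q) := by
  have hd := hdist_nonneg p q
  have h1 := z.lorentz_self
  simp only [hz, lorentz_add_left, lorentz_add_right, lorentz_smul_left, lorentz_smul_right,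
    p.lorentz_self, q.lorentz_self, lorentz_comm q.1 p.1] at h1
  have h2 : cosh (hdist p z) = α + β * cosh (hdist p q) := by
    rw [cosh_hdist, cosh_hdist, hz, lorentz_add_right, lorentz_smul_right, lorentz_smul_right,
      p.lorentz_self]; ring
  have h3 : lorentz p.1 q.1 = -cosh (hdist p q) := by rw [cosh_hdist]; ring
  rw [h3] at h1
  rw [← sq_eq_sq₀ (sinh_nonneg_iff.2 (hdist_nonneg p z))
    (mul_nonneg hβ (sinh_nonneg_iff.2 hd)), mul_pow, sinh_sq, sinh_sq, h2]
  linarith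

lemma hdist_comm (p q : H3) : hdist p q = hdist q p := by
  rw [hdist, hdist, lorentz_comm]

/-- In the hyperboloid model, segments are cut out by nonnegative linear combinations. -/
lemma mem_hsegment_iff (p q z : H3) :
    z ∈ hsegment p q ↔ ∃ α β : ℝ, 0 ≤ α ∧ 0 ≤ β ∧ z.1 = α • p.1 + β • q.1 := by
  change hdist p z + hdist z q = hdist p q ↔ _
  constructor
  · intro h
    have hd1 := hdist_nonneg p z
    have hd2 := hdist_nonneg z q
    rcases eq_or_lt_of_le (hdist_nonneg p q) with h0 | hpos
    · refine ⟨1, 0, zero_le_one, le_rfl, ?_⟩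
      have h1 : hdist p z = 0 := by linarith
      have h2 := cosh_hdist p z
      rw [h1, cosh_zero] at h2
      rw [one_smul, zero_smul, add_zero, eq_of_lorentz_eq_neg_one (p := p) (q := z) (by linarith)]
    · have hs : 0 < sinh (hdist p q) := sinh_pos_iff.2 hpos
      have s1 := sinh_nonneg_iff.2 hd1
      have s2 := sinh_nonneg_iff.2 hd2
      have e1 : lorentz p.1 z.1 = -cosh (hdist p z) := by rw [cosh_hdist]; ring
      have e2 : lorentz z.1 q.1 = -cosh (hdist z q) := by rw [cosh_hdist]; ring
      have e3 : lorentz p.1 q.1 = -cosh (hdist p q) := by rw [cosh_hdist]; ring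
      have hc := cosh_add (hdist p z) (hdist z q)
      have hsn := sinh_add (hdist p z) (hdist z q)
      rw [h] at hc hsn
      have q1 := sinh_sq (hdist p z)
      have q2 := sinh_sq (hdist z q)
      have q3 := sinh_sq (hdist p q)
      refine ⟨sinh (hdist z q) / sinh (hdist p q), sinh (hdist p z) / sinh (hdist p q),
        by positivity, by positivity, ?_⟩
      set a := hdist p z
      set b := hdist z q
      set d := hdist p q
      -- the difference of `z` and the candidate is orthogonal to `z` and isotropic
      have h0 : z.1 - ((sinh b / sinh d) • p.1 + (sinh a / sinh d) • q.1) = 0 := by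
        refine (lorentz_self_nonneg_of_orthogonal z ?_).2 ?_
        · simp only [lorentz_add_left, lorentz_sub_left, lorentz_smul_left, z.lorentz_self,
            lorentz_comm q.1 z.1, e1, e2]
          field_simp
          linarith
        · simp only [lorentz_add_left, lorentz_sub_left, lorentz_smul_left, z.lorentz_self,
            lorentz_comm q.1 z.1, lorentz_comm z.1 p.1, lorentz_comm q.1 p.1, e1, e2, e3,
            lorentz_add_right, lorentz_sub_right, lorentz_smul_right, p.lorentz_self,
            q.lorentz_self]
          field_simp
          rw [hsn, hc]
          have hca := cosh_sq a
          have hcb := cosh_sq b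
          ring_nf
          rw [hca, hcb]
          ring
      exact sub_eq_zero.1 h0
  · rintro ⟨α, β, hα, hβ, hz⟩
    have s1 := sinh_hdist_of_combination hβ hz
    have s2 : sinh (hdist z q) = α * sinh (hdist p q) := by
      rw [hdist_comm z q, hdist_comm p q]
      exact sinh_hdist_of_combination (α := β) hα (by rw [hz, add_comm])
    have c1 : cosh (hdist p z) = α + β * cosh (hdist p q) := by
      rw [cosh_hdist, cosh_hdist, hz, lorentz_add_right, lorentz_smul_right, lorentz_smul_right,
        p.lorentz_self]; ring
    have c2 : cosh (hdist z q) = α * cosh (hdist p q) + β := by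
      rw [cosh_hdist, cosh_hdist, hz, lorentz_add_left, lorentz_smul_left, lorentz_smul_left,
        q.lorentz_self]; ring
    have h1 := z.lorentz_self
    have h3 : lorentz p.1 q.1 = -cosh (hdist p q) := by rw [cosh_hdist]; ring
    simp only [hz, lorentz_add_left, lorentz_add_right, lorentz_smul_left, lorentz_smul_right,
      p.lorentz_self, q.lorentz_self, lorentz_comm q.1 p.1, h3] at h1
    refine cosh_injOn (Set.mem_Ici.2 (add_nonneg (hdist_nonneg p z) (hdist_nonneg z q)))
      (Set.mem_Ici.2 (hdist_nonneg p q)) ?_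
    rw [cosh_add, s1, s2, c1, c2]
    have := sinh_sq (hdist p q)
    linear_combination (-cosh (hdist p q)) * h1 + α * β * this

/-- The linear cone over a ball is closed under addition. -/
lemma exists_smul_of_mem_hclosedBall {Q : H3} {r : ℝ} (hr : 0 ≤ r) {b₁ b₂ : H3}
    (h₁ : b₁ ∈ hclosedBall Q r) (h₂ : b₂ ∈ hclosedBall Q r) {u v : ℝ} (hu : 0 ≤ u) (hv : 0 ≤ v) :
    ∃ (w : ℝ) (b : H3), 0 ≤ w ∧ b ∈ hclosedBall Q r ∧ u • b₁.1 + v • b₂.1 = w • b.1 := by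
  rcases eq_or_lt_of_le (add_nonneg hu hv) with h0 | hpos
  · refine ⟨0, b₁, le_rfl, h₁, ?_⟩
    have hu0 : u = 0 := by linarith
    have hv0 : v = 0 := by linarith
    simp [hu0, hv0]
  · rw [mem_hclosedBall_iff _ _ hr] at h₁ h₂
    have h12 := one_le_neg_lorentz b₁ b₂
    have hself : lorentz (u • b₁.1 + v • b₂.1) (u • b₁.1 + v • b₂.1)
        = -(u ^ 2 + v ^ 2 + 2 * (u * v) * (-lorentz b₁.1 b₂.1)) := by
      simp only [lorentz_add_left, lorentz_add_right, lorentz_smul_left, lorentz_smul_right,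
        b₁.lorentz_self, b₂.lorentz_self, lorentz_comm b₂.1 b₁.1]; ring
    have hge : (u + v) ^ 2 ≤ -lorentz (u • b₁.1 + v • b₂.1) (u • b₁.1 + v • b₂.1) := by
      rw [hself]; nlinarith [mul_nonneg hu hv]
    have hQ : lorentz (u • b₁.1 + v • b₂.1) Q.1 = u * lorentz b₁.1 Q.1 + v * lorentz b₂.1 Q.1 := by
      simp only [lorentz_add_left, lorentz_smul_left]
    have hQneg : lorentz (u • b₁.1 + v • b₂.1) Q.1 < 0 := by
      rw [hQ]
      nlinarith [one_le_neg_lorentz b₁ Q, one_le_neg_lorentz b₂ Q]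
    obtain ⟨w, b, hw, hw2, hb⟩ := exists_eq_smul_of_timelike Q
      (x := u • b₁.1 + v • b₂.1) (by nlinarith [pow_pos hpos 2]) hQneg
    refine ⟨w, b, hw.le, ?_, hb⟩
    rw [mem_hclosedBall_iff _ _ hr]
    have hwge : u + v ≤ w := (le_abs_self _).trans (abs_le_of_sq_le_sq (by linarith) hw.le)
    rw [hb, lorentz_smul_left] at hQ
    have hc := cosh_pos r
    refine le_of_mul_le_mul_left ?_ hw
    nlinarith

/-- The hull of a ball and a point is the union of the segments joining the point to the ball. -/
lemma mem_hconvexHull_iff (T Q : H3) {r : ℝ} (hr : 0 ≤ r) (z : H3) :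
    z ∈ hconvexHull ({T} ∪ hclosedBall Q r) ↔
      ∃ α β : ℝ, ∃ b ∈ hclosedBall Q r, 0 ≤ α ∧ 0 ≤ β ∧ z.1 = α • T.1 + β • b.1 := by
  have hQ : Q ∈ hclosedBall Q r := by
    rw [mem_hclosedBall_iff _ _ hr, Q.lorentz_self, neg_neg]; exact one_le_cosh r
  constructor
  · intro hz
    refine hz {z | ∃ α β : ℝ, ∃ b ∈ hclosedBall Q r, 0 ≤ α ∧ 0 ≤ β ∧ z.1 = α • T.1 + β • b.1}
      ⟨?_, ?_⟩
    · rintro z₁ ⟨α₁, β₁, b₁, hb₁, hα₁, hβ₁, e₁⟩ z₂ ⟨α₂, β₂, b₂, hb₂, hα₂, hβ₂, e₂⟩ y hy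
      obtain ⟨l, m, hl, hm, e⟩ := (mem_hsegment_iff _ _ _).1 hy
      obtain ⟨w, b, hw, hb, eb⟩ := exists_smul_of_mem_hclosedBall hr hb₁ hb₂
        (mul_nonneg hl hβ₁) (mul_nonneg hm hβ₂)
      refine ⟨l * α₁ + m * α₂, w, b, hb, by positivity, hw, ?_⟩
      rw [e, e₁, e₂, ← eb]
      module
    · rintro x (rfl | hx)
      · exact ⟨1, 0, Q, hQ, zero_le_one, le_rfl, by simp⟩
      · exact ⟨0, 1, x, hx, le_rfl, zero_le_one, by simp⟩
  · rintro ⟨α, β, b, hb, hα, hβ, e⟩ K ⟨hK, hsub⟩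
    exact hK T (hsub (Or.inl rfl)) b (hsub (Or.inr hb))
      ((mem_hsegment_iff _ _ _).2 ⟨α, β, hα, hβ, e⟩)

/-- The point `T` and a unit vector `e` orthogonal to it determine the geodesic ray through `T`;
every `Q` different from `T` lies on such a ray. -/
lemma exists_unit_direction {T Q : H3} (h : T ≠ Q) :
    ∃ e : ℝ × E3, lorentz e e = 1 ∧ lorentz T.1 e = 0 ∧
      Q.1 = cosh (hdist T Q) • T.1 + sinh (hdist T Q) • e := by
  have hpos : 0 < hdist T Q := by
    refine lt_of_le_of_ne (hdist_nonneg T Q) fun h0 => h (eq_of_lorentz_eq_neg_one ?_)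
    have := cosh_hdist T Q
    rw [← h0, cosh_zero] at this; linarith
  have hs : 0 < sinh (hdist T Q) := sinh_pos_iff.2 hpos
  have e1 : lorentz T.1 Q.1 = -cosh (hdist T Q) := by rw [cosh_hdist]; ring
  have hsq := sinh_sq (hdist T Q)
  refine ⟨(sinh (hdist T Q))⁻¹ • (Q.1 - cosh (hdist T Q) • T.1), ?_, ?_, ?_⟩
  · simp only [lorentz_sub_left, lorentz_smul_left, lorentz_sub_right, lorentz_smul_right,
      T.lorentz_self, Q.lorentz_self, lorentz_comm Q.1 T.1, e1]
    field_simp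
    linarith
  · simp only [lorentz_sub_right, lorentz_smul_right, T.lorentz_self, e1]
    ring
  · rw [smul_smul, mul_inv_cancel₀ hs.ne', one_smul]; module

/-- A ball not containing `T` lies in its tangent cone with apex `T`. Here `C`, `S` and `c`, `s` are the
hyperbolic cosine and sine of `dist T Q` and of the radius, and `a = -⟨z, T⟩`, `t = ⟨z, e⟩` for a point
`z`, so that `-⟨z, Q⟩ = C a - S t`. -/
lemma tangentCone_of_ball {C S c s a t : ℝ} (hS : 0 < S) (hc : 0 < c) (hcC : c < C)
    (hC2 : C ^ 2 = S ^ 2 + 1) (hc2 : c ^ 2 = s ^ 2 + 1) (ha : 1 ≤ a) (hb : C * a - S * t ≤ c) :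
    0 ≤ t ∧ (S ^ 2 - s ^ 2) * (a ^ 2 - 1) ≤ S ^ 2 * t ^ 2 := by
  constructor
  · by_contra hneg
    nlinarith
  · have h2 : 0 ≤ C * a - c := by nlinarith
    have h3 : (C * a - c) ^ 2 ≤ (S * t) ^ 2 := pow_le_pow_left₀ h2 (by linarith) 2
    have h4 : S ^ 2 - s ^ 2 = C ^ 2 - c ^ 2 := by linarith
    rw [h4]
    nlinarith [sq_nonneg (C - c * a)]

/-- The polynomial `α ↦ ⟨x, Q⟩² + cosh² r ⟨x, x⟩`, `x = z - α T`, is nonpositive at its vertex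
when `z` lies in the tangent cone. The letters are those of `tangentCone_of_ball`, and
`⟨x, x⟩ = -(1 - 2 α a + α²)`. -/
lemma polar_vertex_nonpos {C S c a t α : ℝ} (hΔ : 0 < C ^ 2 - c ^ 2)
    (hα : (a - α) * (C ^ 2 - c ^ 2) = S * C * t)
    (hcone : (C ^ 2 - c ^ 2) * (a ^ 2 - 1) ≤ S ^ 2 * t ^ 2) :
    (C * (a - α) - S * t) ^ 2 ≤ c ^ 2 * (1 - 2 * α * a + α ^ 2) := by
  refine le_of_mul_le_mul_right ?_ hΔ
  have h0 : 0 ≤ c ^ 2 * (S ^ 2 * t ^ 2 - (C ^ 2 - c ^ 2) * (a ^ 2 - 1)) :=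
    mul_nonneg (sq_nonneg c) (by linarith)
  have key : (C * (a - α) - S * t) ^ 2 * (C ^ 2 - c ^ 2)
      = c ^ 2 * (1 - 2 * α * a + α ^ 2) * (C ^ 2 - c ^ 2)
        - c ^ 2 * (S ^ 2 * t ^ 2 - (C ^ 2 - c ^ 2) * (a ^ 2 - 1))
        + ((a - α) * (C ^ 2 - c ^ 2) - S * C * t) ^ 2 := by ring
  rw [key, hα, sub_self]
  linarith

/-- Beyond the polar plane, the polynomial `α ↦ ⟨x, Q⟩² + cosh² r ⟨x, x⟩`, `x = z - α T`, increases
on `0 ≤ α`; so if it is nonpositive at some such `α`, then it is nonpositive at `0`. -/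
lemma polar_zero_le {C S c a t α : ℝ} (hα : 0 ≤ α) (hΔ : 0 ≤ C ^ 2 - c ^ 2)
    (hB : (C ^ 2 - c ^ 2) * a ≤ S * C * t)
    (hf : (C * (a - α) - S * t) ^ 2 ≤ c ^ 2 * (1 - 2 * α * a + α ^ 2)) :
    (C * a - S * t) ^ 2 ≤ c ^ 2 := by
  have h8 : 0 ≤ α * (S * C * t - (C ^ 2 - c ^ 2) * a) := mul_nonneg hα (by linarith)
  have h9 : 0 ≤ α ^ 2 * (C ^ 2 - c ^ 2) := by positivity
  linarith

set_option maxHeartbeats 1000000 in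
/-- With `a = -⟨z, T⟩` and `t = ⟨z, e⟩`, a point `z` lies in the convex hull of `T` and a ball
not containing `T` if and only if it lies in the ball, or in the part of the tangent cone with
apex `T` which is on the same side as `T` of the polar plane of `T`, the plane through the circle
of tangency. -/
lemma mem_hconvexHull_iff_cone {T Q : H3} {e : ℝ × E3} {D r : ℝ}
    (hTe : lorentz T.1 e = 0) (hQ : Q.1 = cosh D • T.1 + sinh D • e) (hr : 0 < r) (hD : r < D)
    (z : H3) :
    z ∈ hconvexHull ({T} ∪ hclosedBall Q r) ↔ z ∈ hclosedBall Q r ∨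
      (0 ≤ lorentz z.1 e ∧
        (sinh D ^ 2 - sinh r ^ 2) * (lorentz z.1 T.1 ^ 2 - 1) ≤ sinh D ^ 2 * lorentz z.1 e ^ 2 ∧
        sinh D * cosh D * lorentz z.1 e
          ≤ (sinh D ^ 2 - sinh r ^ 2) * -lorentz z.1 T.1) := by
  have hS : 0 < sinh D := sinh_pos_iff.2 (hr.trans hD)
  have hs : 0 < sinh r := sinh_pos_iff.2 hr
  have hsS : sinh r < sinh D := sinh_lt_sinh.2 hD
  have hc1 : 0 < cosh r := cosh_pos r
  have hcC : cosh r < cosh D := by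
    rw [cosh_lt_cosh, abs_of_pos hr, abs_of_pos (hr.trans hD)]; exact hD
  have hC2 := cosh_sq D
  have hc2 := cosh_sq r
  have hzQ : ∀ x : ℝ × E3, lorentz x Q.1 = cosh D * lorentz x T.1 + sinh D * lorentz x e := by
    intro x; rw [hQ, lorentz_add_right, lorentz_smul_right, lorentz_smul_right]
  have hball : ∀ x : H3, x ∈ hclosedBall Q r ↔
      cosh D * -lorentz x.1 T.1 - sinh D * lorentz x.1 e ≤ cosh r := by
    intro x; rw [mem_hclosedBall_iff _ _ hr.le, hzQ]
    constructor <;> intro h <;> linarith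
  rw [mem_hconvexHull_iff T Q hr.le]
  set C := cosh D
  set S := sinh D
  set c := cosh r
  set s := sinh r
  have hΔ : 0 < S ^ 2 - s ^ 2 := by nlinarith
  have hza := one_le_neg_lorentz z T
  constructor
  · rintro ⟨α, β, b, hb, hα, hβ, hz⟩
    rw [hball] at hb
    have hba := one_le_neg_lorentz b T
    have ha : -lorentz z.1 T.1 = α + β * -lorentz b.1 T.1 := by
      rw [hz, lorentz_add_left, lorentz_smul_left, lorentz_smul_left, T.lorentz_self]; ring
    have ht : lorentz z.1 e = β * lorentz b.1 e := by
      rw [hz, lorentz_add_left, lorentz_smul_left, lorentz_smul_left, hTe]; ring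
    have h1 := z.lorentz_self
    simp only [hz, lorentz_add_left, lorentz_add_right, lorentz_smul_left, lorentz_smul_right,
      T.lorentz_self, b.lorentz_self, lorentz_comm T.1 b.1] at h1
    rw [hball]
    rw [← neg_sq (lorentz z.1 T.1)]
    set a := -lorentz z.1 T.1
    set t := lorentz z.1 e
    set t' := lorentz b.1 e
    have hbT : lorentz b.1 T.1 = -(-lorentz b.1 T.1) := by ring
    rw [hbT] at h1
    set a' := -lorentz b.1 T.1
    obtain ⟨ht', hbc⟩ := tangentCone_of_ball hS hc1 hcC hC2 hc2 hba hb
    have hcone : (S ^ 2 - s ^ 2) * (a ^ 2 - 1) ≤ S ^ 2 * t ^ 2 := by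
      have h2 : a ^ 2 - 1 - t ^ 2 = β ^ 2 * (a' ^ 2 - 1 - t' ^ 2) := by
        rw [ha, ht]; linear_combination -h1
      have h3 : 0 ≤ β ^ 2 * (S ^ 2 * t' ^ 2 - (S ^ 2 - s ^ 2) * (a' ^ 2 - 1)) :=
        mul_nonneg (sq_nonneg β) (by linarith)
      have h4 : t ^ 2 = β ^ 2 * t' ^ 2 := by rw [ht]; ring
      have h5 : a ^ 2 - 1 = β ^ 2 * (a' ^ 2 - 1) := by rw [h4] at h2; linear_combination h2
      rw [h5, h4]; linear_combination h3
    by_cases hB : S * C * t ≤ (S ^ 2 - s ^ 2) * a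
    · exact Or.inr ⟨by rw [ht]; positivity, hcone, hB⟩
    · left
      -- beyond the polar plane, the polynomial of `polar_zero_le` is at most as large at `0` as at `α`
      have hf : (C * (a - α) - S * t) ^ 2 ≤ c ^ 2 * (1 - 2 * α * a + α ^ 2) := by
        have h2 : (C * a' - S * t') ^ 2 ≤ c ^ 2 := by
          have h6 : 0 ≤ C * a' - S * t' := by
            have h7 := one_le_neg_lorentz b Q
            rw [hzQ] at h7
            simp only [a', t']; linarith
          exact pow_le_pow_left₀ h6 hb 2
        have h3 : 1 - 2 * α * a + α ^ 2 = β ^ 2 := by rw [ha]; linear_combination h1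
        have h4 : C * (a - α) - S * t = β * (C * a' - S * t') := by rw [ha, ht]; ring
        rw [h3, h4, mul_pow]
        nlinarith [sq_nonneg β]
      have h5 : (C * a - S * t) ^ 2 ≤ c ^ 2 := by
        have h10 : S ^ 2 - s ^ 2 = C ^ 2 - c ^ 2 := by linarith
        rw [h10] at hB hΔ
        exact polar_zero_le hα hΔ.le (not_le.1 hB).le hf
      exact (le_abs_self _).trans (abs_le_of_sq_le_sq h5 hc1.le)
  · rintro (hb | ⟨ht, hcone, hB⟩)
    · exact ⟨0, 1, z, hb, le_rfl, zero_le_one, by simp⟩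
    · have hzT : lorentz z.1 T.1 = -(-lorentz z.1 T.1) := by ring
      rw [← neg_sq (lorentz z.1 T.1)] at hcone
      set a := -lorentz z.1 T.1
      set t := lorentz z.1 e
      rcases eq_or_lt_of_le ht with ht0 | htpos
      · have ha : a = 1 := by
          rw [← ht0] at hcone
          have h1 : (S ^ 2 - s ^ 2) * (a ^ 2 - 1) ≤ 0 := by linarith
          have h2 : a ^ 2 - 1 ≤ 0 := by
            by_contra h3
            exact absurd (mul_pos hΔ (not_le.1 h3)) (not_lt.2 h1)
          exact le_antisymm (by nlinarith) hza
        have hzTeq : z = T := eq_of_lorentz_eq_neg_one (by rw [hzT, ha])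
        refine ⟨1, 0, Q, ?_, zero_le_one, le_rfl, by rw [hzTeq]; simp⟩
        rw [mem_hclosedBall_iff _ _ hr.le, Q.lorentz_self, neg_neg]
        exact one_le_cosh r
      · -- the vertex of the quadratic polynomial `α ↦ ⟨x, Q⟩² + cosh² r ⟨x, x⟩`, `x = z - α T`
        set α := a - S * C * t / (S ^ 2 - s ^ 2) with hαdef
        have hαm : (a - α) * (S ^ 2 - s ^ 2) = S * C * t := by
          rw [hαdef]; field_simp; ring
        have hα : 0 ≤ α := by
          have : S * C * t / (S ^ 2 - s ^ 2) ≤ a := by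
            rw [div_le_iff₀ hΔ]; linarith
          linarith
        have hC0 : 0 < C := hc1.trans hcC
        have haα : 0 < a - α := by
          have : 0 < (a - α) * (S ^ 2 - s ^ 2) := by rw [hαm]; positivity
          exact pos_of_mul_pos_left this hΔ.le
        have hxx : lorentz (z.1 - α • T.1) (z.1 - α • T.1) = -(1 - 2 * α * a + α ^ 2) := by
          simp only [lorentz_sub_left, lorentz_sub_right, lorentz_smul_left, lorentz_smul_right,
            z.lorentz_self, T.lorentz_self, lorentz_comm T.1 z.1, hzT]; ring
        have hxT : lorentz (z.1 - α • T.1) T.1 = -(a - α) := by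
          rw [lorentz_sub_left, lorentz_smul_left, T.lorentz_self, hzT]; ring
        have hxe : lorentz (z.1 - α • T.1) e = t := by
          rw [lorentz_sub_left, lorentz_smul_left, hTe]; ring
        have hxQ : lorentz (z.1 - α • T.1) Q.1 = -(C * (a - α) - S * t) := by
          rw [hzQ, hxT, hxe]; ring
        have hQpos : 0 < C * (a - α) - S * t := by
          have h1 : (C * (a - α) - S * t) * (S ^ 2 - s ^ 2) = S * t * c ^ 2 := by
            have : (C * (a - α) - S * t) * (S ^ 2 - s ^ 2)
              = C * ((a - α) * (S ^ 2 - s ^ 2)) - S * t * (S ^ 2 - s ^ 2) := by ring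
            rw [this, hαm]
            have : S ^ 2 - s ^ 2 = C ^ 2 - c ^ 2 := by linarith
            rw [this]; ring
          have : 0 < (C * (a - α) - S * t) * (S ^ 2 - s ^ 2) := by rw [h1]; positivity
          exact pos_of_mul_pos_left this hΔ.le
        have hf : (C * (a - α) - S * t) ^ 2 ≤ c ^ 2 * (1 - 2 * α * a + α ^ 2) := by
          have hΔc : S ^ 2 - s ^ 2 = C ^ 2 - c ^ 2 := by linarith
          rw [hΔc] at hΔ hαm hcone
          exact polar_vertex_nonpos hΔ hαm hcone
        have hneg : lorentz (z.1 - α • T.1) (z.1 - α • T.1) < 0 := by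
          rw [hxx]
          have : 0 < c ^ 2 * (1 - 2 * α * a + α ^ 2) := lt_of_lt_of_le (by positivity) hf
          have := pos_of_mul_pos_left (by rwa [mul_comm] at this) (sq_nonneg c)
          linarith
        obtain ⟨w, b, hw, hw2, hb⟩ := exists_eq_smul_of_timelike T hneg (by rw [hxT]; linarith)
        refine ⟨α, w, b, ?_, hα, hw.le, by rw [← hb]; module⟩
        rw [mem_hclosedBall_iff _ _ hr.le]
        have h1 : lorentz (z.1 - α • T.1) Q.1 = w * lorentz b.1 Q.1 := by
          rw [hb, lorentz_smul_left]
        have h2 : w * -lorentz b.1 Q.1 = C * (a - α) - S * t := by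
          rw [hxQ] at h1; linarith
        refine le_of_mul_le_mul_left ?_ hw
        rw [h2]
        refine (le_abs_self _).trans (abs_le_of_sq_le_sq ?_ (by positivity))
        rw [mul_pow, hw2, hxx]
        linarith

open MeasureTheory Set
open scoped Pointwise

/-! ### Lorentz reflections preserve the volume -/

/-- The Lorentz reflection in the hyperplane orthogonal to `u` (meaningful for `⟨u, u⟩ ≠ 0`). -/
def lorentzRefl (u p : ℝ × E3) : ℝ × E3 := p - (2 * lorentz p u / lorentz u u) • u

lemma lorentz_lorentzRefl {u : ℝ × E3} (hu : lorentz u u ≠ 0) (p q : ℝ × E3) :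
    lorentz (lorentzRefl u p) (lorentzRefl u q) = lorentz p q := by
  simp only [lorentzRefl, lorentz_sub_left, lorentz_sub_right, lorentz_smul_left,
    lorentz_smul_right, lorentz_comm u]
  field_simp
  ring

lemma lorentzRefl_lorentzRefl {u : ℝ × E3} (hu : lorentz u u ≠ 0) (p : ℝ × E3) :
    lorentzRefl u (lorentzRefl u p) = p := by
  have h : lorentz (lorentzRefl u p) u = -lorentz p u := by
    simp only [lorentzRefl, lorentz_sub_left, lorentz_smul_left]
    field_simp
    ring
  rw [lorentzRefl, h, lorentzRefl]
  module

lemma lorentzRefl_sub {x y : ℝ × E3} (h : lorentz x x = lorentz y y)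
    (hu : lorentz (x - y) (x - y) ≠ 0) : lorentzRefl (x - y) x = y := by
  have h1 : lorentz (x - y) (x - y) = 2 * lorentz x (x - y) := by
    simp only [lorentz_sub_left, lorentz_sub_right, lorentz_comm y x] at h ⊢
    linarith
  rw [lorentzRefl, ← h1, div_self hu, one_smul, sub_sub_cancel]

lemma lorentzRefl_of_orthogonal {u p : ℝ × E3} (h : lorentz p u = 0) : lorentzRefl u p = p := by
  simp [lorentzRefl, h]

/-- The reflection in a spacelike vector, as a self-map of `H3`. -/
def reflH3 (u : ℝ × E3) (hu : 0 < lorentz u u) (p : H3) : H3 :=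
  ⟨lorentzRefl u p.1, by
    have h1 : lorentz (lorentzRefl u p.1) (lorentzRefl u p.1) = -1 := by
      rw [lorentz_lorentzRefl hu.ne', p.lorentz_self]
    refine ⟨h1, (fst_pos_iff_lorentz_neg p (by rw [h1]; norm_num)).2 ?_⟩
    rw [lorentzRefl, lorentz_sub_left, lorentz_smul_left, p.lorentz_self, lorentz_comm u p.1]
    have : 0 ≤ 2 * lorentz p.1 u / lorentz u u * lorentz p.1 u := by
      have : 2 * lorentz p.1 u / lorentz u u * lorentz p.1 u
        = 2 * lorentz p.1 u ^ 2 / lorentz u u := by ring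
      rw [this]; positivity
    linarith⟩

lemma lift_snd (p : H3) : lift p.1.2 = p := by
  refine Subtype.ext (Prod.ext ?_ rfl)
  change √(1 + ‖p.1.2‖ ^ 2) = p.1.1
  rw [p.norm_sq, add_sub_cancel, sqrt_sq p.fst_pos.le]

lemma lift_injective : Function.Injective lift := fun _ _ h => congrArg (fun p : H3 => p.1.2) h

/-- The derivative of `lift` at `x`, as a map into Minkowski space. -/
def liftDeriv (x : E3) : E3 →L[ℝ] ℝ × E3 :=
  ((√(1 + ‖x‖ ^ 2))⁻¹ • innerSL ℝ x).prod (ContinuousLinearMap.id ℝ E3)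

lemma hasFDerivAt_lift (x : E3) : HasFDerivAt (fun y => (lift y).1) (liftDeriv x) x := by
  have h1 : HasFDerivAt (fun y : E3 => 1 + ‖y‖ ^ 2) (2 • innerSL ℝ x) x :=
    ((hasStrictFDerivAt_norm_sq x).hasFDerivAt).const_add 1
  have h2 := h1.sqrt (by positivity)
  refine (HasFDerivAt.prodMk (h2.congr_fderiv ?_) (hasFDerivAt_id x))
  ext v
  simp
  ring

lemma liftDeriv_single (x : E3) (i : Fin 3) :
    liftDeriv x (EuclideanSpace.single i 1) = tangentVec x i := by
  refine Prod.ext ?_ rfl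
  simp [liftDeriv, tangentVec, EuclideanSpace.inner_single_right]
  ring

lemma lorentz_sum_left {ι : Type*} (s : Finset ι) (f : ι → ℝ × E3) (x : ℝ × E3) :
    lorentz (∑ i ∈ s, f i) x = ∑ i ∈ s, lorentz (f i) x := by
  classical
  induction s using Finset.induction_on with
  | empty => simp [lorentz]
  | insert a s ha ih => rw [Finset.sum_insert ha, Finset.sum_insert ha, lorentz_add_left, ih]

lemma lorentz_sum_right {ι : Type*} (s : Finset ι) (f : ι → ℝ × E3) (x : ℝ × E3) :
    lorentz x (∑ i ∈ s, f i) = ∑ i ∈ s, lorentz x (f i) := by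
  simp only [lorentz_comm x, lorentz_sum_left]

/-- The Gram determinant transforms by the square of the Jacobian under a map of the chart
that is induced by a Lorentz transformation. -/
lemma det_metricTensor_of_comp {x y : E3} (A : E3 →L[ℝ] E3)
    (h : ∀ v w, lorentz (liftDeriv y (A v)) (liftDeriv y (A w))
      = lorentz (liftDeriv x v) (liftDeriv x w)) :
    (metricTensor x).det = A.det ^ 2 * (metricTensor y).det := by
  set b := (EuclideanSpace.basisFun (Fin 3) ℝ).toBasis
  have hb : ∀ i, b i = EuclideanSpace.single i 1 := fun i => by simp [b]
  set M := LinearMap.toMatrix b b (A : E3 →ₗ[ℝ] E3)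
  have hA : ∀ i, A (b i) = ∑ k, M k i • b k := fun i => by
    have := (b.sum_repr (A (b i))).symm
    rw [this]
    simp [M, LinearMap.toMatrix_apply]
  have hM : metricTensor x = M.transpose * metricTensor y * M := by
    ext i j
    have h1 := h (b i) (b j)
    simp only [hA, map_sum, map_smul, lorentz_sum_left, lorentz_sum_right, lorentz_smul_left,
      lorentz_smul_right] at h1
    simp only [hb, liftDeriv_single] at h1
    simp only [metricTensor, Matrix.mul_apply, Matrix.of_apply, Matrix.transpose_apply, ← h1]
    exact Finset.sum_congr rfl fun k _ => mul_comm _ _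
  have hdet : M.det = A.det := by
    simp only [M, LinearMap.det_toMatrix]
  rw [hM, Matrix.det_mul, Matrix.det_mul, Matrix.det_transpose, hdet]
  ring

lemma measurable_lorentz_right (n : ℝ × E3) : Measurable fun p : H3 => lorentz p.1 n := by
  have h : Measurable fun p : ℝ × E3 => lorentz p n := by
    unfold lorentz; fun_prop
  exact h.comp measurable_subtype_coe

lemma hvol_apply {A : Set H3} (hA : MeasurableSet A) :
    hvol A = ∫⁻ x in lift ⁻¹' A, ENNReal.ofReal √(metricTensor x).det := by
  rw [hvol, Measure.map_apply measurable_lift hA, withDensity_apply _ (measurable_lift hA)]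

/-- The reflection as a continuous linear map. -/
def lorentzReflL (u : ℝ × E3) : (ℝ × E3) →L[ℝ] ℝ × E3 :=
  LinearMap.toContinuousLinearMap
    { toFun := lorentzRefl u
      map_add' := fun p q => by
        simp only [lorentzRefl, lorentz_add_left, mul_add, add_div]; module
      map_smul' := fun a p => by
        simp only [lorentzRefl, lorentz_smul_left, RingHom.id_apply]
        rw [smul_sub, smul_smul]; congr 2; ring }

lemma measurable_reflH3 (u : ℝ × E3) (hu : 0 < lorentz u u) : Measurable (reflH3 u hu) :=
  Measurable.subtype_mk ((lorentzReflL u).continuous.measurable.comp measurable_subtype_coe)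

lemma reflH3_reflH3 (u : ℝ × E3) (hu : 0 < lorentz u u) (p : H3) :
    reflH3 u hu (reflH3 u hu p) = p := Subtype.ext (lorentzRefl_lorentzRefl hu.ne' p.1)

/-- In the chart the reflection is a smooth involution, and its Jacobian compensates the change of
`√(det g)`. -/
lemma measurePreserving_reflH3 (u : ℝ × E3) (hu : 0 < lorentz u u) :
    MeasurePreserving (reflH3 u hu) hvol hvol := by
  refine ⟨measurable_reflH3 u hu, Measure.ext fun A hA => ?_⟩
  rw [Measure.map_apply (measurable_reflH3 u hu) hA, hvol_apply (measurable_reflH3 u hu hA),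
    hvol_apply hA]
  -- the reflection in the chart
  set F : E3 → E3 := fun x => (reflH3 u hu (lift x)).1.2 with hF
  have hlift : ∀ x, lift (F x) = reflH3 u hu (lift x) := fun x => lift_snd _
  have hinv : ∀ x, F (F x) = x := fun x => by
    apply lift_injective
    rw [hlift, hlift, reflH3_reflH3]
  set F' : E3 → E3 →L[ℝ] E3 := fun x =>
    (ContinuousLinearMap.snd ℝ ℝ E3).comp ((lorentzReflL u).comp (liftDeriv x))
  have hF' : ∀ x, HasFDerivAt F (F' x) x := fun x =>
    ((ContinuousLinearMap.snd ℝ ℝ E3).comp (lorentzReflL u)).hasFDerivAt.comp x (hasFDerivAt_lift x)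
  have hchain : ∀ x, (liftDeriv (F x)).comp (F' x) = (lorentzReflL u).comp (liftDeriv x) := by
    intro x
    have h1 := (hasFDerivAt_lift (F x)).comp x (hF' x)
    have h2 := ((lorentzReflL u).hasFDerivAt).comp x (hasFDerivAt_lift x)
    refine h1.unique (h2.congr_of_eventuallyEq (Filter.Eventually.of_forall fun y => ?_))
    change (lift (F y)).1 = lorentzRefl u (lift y).1
    rw [hlift]; rfl
  have himg : lift ⁻¹' A = F '' (lift ⁻¹' (reflH3 u hu ⁻¹' A)) := by
    ext x
    constructor
    · intro hx
      refine ⟨F x, ?_, hinv x⟩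
      change reflH3 u hu (lift (F x)) ∈ A
      rw [← hlift, hinv]; exact hx
    · rintro ⟨y, hy, rfl⟩
      change lift (F y) ∈ A
      rw [hlift]; exact hy
  rw [himg, lintegral_image_eq_lintegral_abs_det_fderiv_mul volume
    (measurable_lift (measurable_reflH3 u hu hA)) (fun x _ => (hF' x).hasFDerivWithinAt)
    (fun x _ y _ h => by rw [← hinv x, h, hinv])]
  refine lintegral_congr fun x => ?_
  rw [← ENNReal.ofReal_mul (abs_nonneg _), det_metricTensor_of_comp (x := x) (y := F x) (F' x),
    sqrt_mul (sq_nonneg _), sqrt_sq_eq_abs]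
  intro v w
  have e : ∀ v, liftDeriv (F x) (F' x v) = lorentzRefl u (liftDeriv x v) := fun v =>
    DFunLike.congr_fun (hchain x) v
  rw [e, e, lorentz_lorentzRefl hu.ne']

lemma origin_val : origin.1 = (1, 0) := by
  simp [origin, lift]

lemma lorentz_origin (p : ℝ × E3) : lorentz p origin.1 = -p.1 := by
  rw [origin_val]; simp [lorentz]

/-- Isometries act transitively on pairs of a point and a vector with given products: some
volume-preserving map of `H3` carries `T` to `origin` and `n` to `n'`. -/
lemma exists_isometry (T : H3) {n n' : ℝ × E3} (hn : lorentz n n = lorentz n' n')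
    (hT : lorentz n T.1 = lorentz n' origin.1) :
    ∃ g : H3 → H3, MeasurePreserving g hvol hvol ∧
      ∀ p, lorentz (g p).1 origin.1 = lorentz p.1 T.1 ∧ lorentz (g p).1 n' = lorentz p.1 n := by
  -- a product of two reflections, the first moving `T`, the second fixing `origin`
  have step1 : ∃ (g : H3 → H3) (m : ℝ × E3), MeasurePreserving g hvol hvol ∧
      lorentz m m = lorentz n' n' ∧ lorentz m origin.1 = lorentz n' origin.1 ∧
      ∀ p, lorentz (g p).1 origin.1 = lorentz p.1 T.1 ∧ lorentz (g p).1 m = lorentz p.1 n := by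
    by_cases h : T = origin
    · subst h
      exact ⟨id, n, MeasurePreserving.id _, hn, hT, fun p => ⟨rfl, rfl⟩⟩
    · have hu : 0 < lorentz (T.1 - origin.1) (T.1 - origin.1) := by
        have h1 := one_le_neg_lorentz T origin
        have h2 : lorentz T.1 origin.1 ≠ -1 := fun h3 => h (eq_of_lorentz_eq_neg_one h3)
        simp only [lorentz_sub_left, lorentz_sub_right, T.lorentz_self, origin.lorentz_self,
          lorentz_comm origin.1 T.1]
        have h4 := lt_of_le_of_ne h1 (fun h5 => h2 (by linarith))
        linarith
      have hTo : lorentzRefl (T.1 - origin.1) T.1 = origin.1 :=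
        lorentzRefl_sub (by rw [T.lorentz_self, origin.lorentz_self]) hu.ne'
      refine ⟨reflH3 _ hu, lorentzRefl (T.1 - origin.1) n, measurePreserving_reflH3 _ hu, ?_, ?_,
        fun p => ⟨?_, lorentz_lorentzRefl hu.ne' _ _⟩⟩
      · rw [lorentz_lorentzRefl hu.ne', hn]
      · nth_rewrite 2 [← hTo]
        rw [lorentz_lorentzRefl hu.ne', hT]
      · nth_rewrite 2 [← hTo]
        exact lorentz_lorentzRefl hu.ne' _ _
  obtain ⟨g, m, hg, hm, hmo, hgp⟩ := step1
  by_cases h : m = n'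
  · subst h; exact ⟨g, hg, hgp⟩
  · have h1 : (m - n').1 = 0 := by
      rw [lorentz_origin, lorentz_origin] at hmo
      simp only [Prod.fst_sub]; linarith
    have hu : 0 < lorentz (m - n') (m - n') := by
      rw [lorentz_self, h1]
      have : (m - n').2 ≠ 0 := fun h2 => h (sub_eq_zero.1 (Prod.ext h1 h2))
      have := norm_pos_iff.2 this
      nlinarith
    have hmn : lorentzRefl (m - n') m = n' := lorentzRefl_sub hm hu.ne'
    have ho : lorentzRefl (m - n') origin.1 = origin.1 := lorentzRefl_of_orthogonal (by
      rw [lorentz_comm, lorentz_origin, h1, neg_zero])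
    refine ⟨reflH3 _ hu ∘ g, (measurePreserving_reflH3 _ hu).comp hg, fun p => ⟨?_, ?_⟩⟩
    · rw [← (hgp p).1]
      nth_rewrite 1 [← ho]
      exact lorentz_lorentzRefl hu.ne' _ _
    · rw [← (hgp p).2]
      nth_rewrite 2 [← hmn]
      exact lorentz_lorentzRefl hu.ne' _ _

/-! ### Balls, half-spaces and planes -/

lemma det_metricTensor (x : E3) : (metricTensor x).det = (1 + ‖x‖ ^ 2)⁻¹ := by
  have hx : ‖x‖ ^ 2 = x 0 ^ 2 + x 1 ^ 2 + x 2 ^ 2 := by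
    rw [EuclideanSpace.norm_sq_eq, Fin.sum_univ_three]; simp
  have hpos : (0:ℝ) < 1 + ‖x‖ ^ 2 := by positivity
  have hm : ∀ i j, metricTensor x i j
      = (if i = j then 1 else 0) - x i * x j / (1 + ‖x‖ ^ 2) := by
    intro i j
    have h1 : x i / √(1 + ‖x‖ ^ 2) * (x j / √(1 + ‖x‖ ^ 2)) = x i * x j / (1 + ‖x‖ ^ 2) := by
      rw [div_mul_div_comm, mul_self_sqrt hpos.le]
    simp only [metricTensor, Matrix.of_apply, lorentz, tangentVec, h1]
    congr 1
    simp [EuclideanSpace.inner_single_left]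
  rw [Matrix.det_fin_three]
  simp only [hm]
  simp
  field_simp
  rw [hx]
  ring

lemma hvol_apply' {A : Set H3} (hA : MeasurableSet A) :
    hvol A = ∫⁻ x in lift ⁻¹' A, ENNReal.ofReal (√(1 + ‖x‖ ^ 2))⁻¹ := by
  rw [hvol_apply hA]
  simp only [det_metricTensor, sqrt_inv]

lemma measurableSet_hclosedBall (c : H3) {r : ℝ} (hr : 0 ≤ r) :
    MeasurableSet (hclosedBall c r) := by
  have : hclosedBall c r = {p : H3 | -lorentz p.1 c.1 ≤ cosh r} := by
    ext p; exact mem_hclosedBall_iff p c hr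
  rw [this]
  exact measurableSet_le (measurable_lorentz_right c.1).neg measurable_const

lemma measurableSet_origin_ball (R : ℝ) :
    MeasurableSet {p : H3 | -lorentz p.1 origin.1 ≤ R} :=
  measurableSet_le (measurable_lorentz_right _).neg measurable_const

lemma hvol_origin_ball_lt_top (R : ℝ) : hvol {p : H3 | -lorentz p.1 origin.1 ≤ R} < ⊤ := by
  rw [hvol_apply' (measurableSet_origin_ball R)]
  have hsub : lift ⁻¹' {p : H3 | -lorentz p.1 origin.1 ≤ R} ⊆ Metric.closedBall 0 |R| := by
    intro x hx
    have hx1 : √(1 + ‖x‖ ^ 2) ≤ R := by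
      simpa [lorentz_origin, lift] using hx
    rw [mem_closedBall_zero_iff]
    refine le_trans ?_ (hx1.trans (le_abs_self R))
    exact le_sqrt_of_sq_le (by linarith)
  calc _ ≤ ∫⁻ x in lift ⁻¹' {p : H3 | -lorentz p.1 origin.1 ≤ R}, 1 := by
        refine lintegral_mono fun x => ?_
        rw [ENNReal.ofReal_le_one]
        exact inv_le_one_of_one_le₀ (one_le_sqrt.2 (by nlinarith [sq_nonneg ‖x‖]))
    _ = volume (lift ⁻¹' {p : H3 | -lorentz p.1 origin.1 ≤ R}) := by simp
    _ ≤ volume (Metric.closedBall (0 : E3) |R|) := measure_mono hsub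
    _ < ⊤ := measure_closedBall_lt_top

lemma hvol_hclosedBall_ne_top (c : H3) {r : ℝ} (hr : 0 ≤ r) : hvol (hclosedBall c r) ≠ ⊤ := by
  obtain ⟨g, hg, hgp⟩ := exists_isometry c (n := c.1) (n' := origin.1)
    (by rw [c.lorentz_self, origin.lorentz_self]) (by rw [c.lorentz_self, origin.lorentz_self])
  have h : hclosedBall c r = g ⁻¹' {p : H3 | -lorentz p.1 origin.1 ≤ cosh r} := by
    ext p
    rw [mem_hclosedBall_iff p c hr]
    simp only [mem_preimage, mem_ofPred_eq, (hgp p).1]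
  rw [h, hg.measure_preimage (measurableSet_origin_ball _).nullMeasurableSet]
  exact (hvol_origin_ball_lt_top _).ne

lemma measurableSet_halfSpace (n : ℝ × E3) : MeasurableSet {p : H3 | 0 ≤ lorentz p.1 n} :=
  measurableSet_le measurable_const (measurable_lorentz_right n)

/-- The volume of a ball cut by a half-space with unit inner normal `n` is `κ`, the signed distance
`w` of the plane being read off from the product of `n` with the centre. -/
lemma hvol_hclosedBall_inter_halfSpace (c : H3) {n : ℝ × E3} {r w : ℝ} (hr : 0 ≤ r)
    (hn : lorentz n n = 1) (hc : lorentz n c.1 = -sinh w) :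
    hvol.real (hclosedBall c r ∩ {p : H3 | 0 ≤ lorentz p.1 n}) = kappa r w := by
  set n' : ℝ × E3 := (sinh w, EuclideanSpace.single 0 (cosh w)) with hn'
  have h1 : lorentz n' n' = 1 := by
    rw [lorentz_self, hn']
    simp only [PiLp.norm_single, norm_eq_abs, sq_abs]
    linarith [cosh_sq w]
  obtain ⟨g, hg, hgp⟩ := exists_isometry c (n := n) (n' := n') (by rw [hn, h1])
    (by rw [hc, lorentz_origin])
  have h : hclosedBall c r ∩ {p : H3 | 0 ≤ lorentz p.1 n}
      = g ⁻¹' (hclosedBall origin r ∩ halfSpace w) := by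
    ext p
    simp only [mem_inter_iff, mem_preimage, mem_hclosedBall_iff _ _ hr, (hgp p).1, mem_ofPred_eq,
      halfSpace, ← hn', (hgp p).2]
  have hm : MeasurableSet (hclosedBall origin r ∩ halfSpace w) :=
    (measurableSet_hclosedBall origin hr).inter (measurableSet_halfSpace n')
  rw [h, measureReal_def, hg.measure_preimage hm.nullMeasurableSet]
  rfl

/-- A hyperbolic plane has volume zero: it may be moved to pass through `origin`, and there it is
a linear plane of the chart. -/
lemma hvol_plane {c : H3} {n : ℝ × E3} (hn : lorentz n n = 1) (hc : lorentz n c.1 = 0) :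
    hvol {p : H3 | lorentz p.1 n = 0} = 0 := by
  set n' : ℝ × E3 := (0, EuclideanSpace.single 0 1) with hn'
  have h1 : lorentz n' n' = 1 := by
    rw [lorentz_self, hn']; simp
  obtain ⟨g, hg, hgp⟩ := exists_isometry c (n := n) (n' := n') (by rw [hn, h1])
    (by rw [hc, lorentz_origin, hn', neg_zero])
  have hm : MeasurableSet {p : H3 | lorentz p.1 n' = 0} :=
    measurable_lorentz_right n' (measurableSet_singleton 0)
  have h : {p : H3 | lorentz p.1 n = 0} = g ⁻¹' {p : H3 | lorentz p.1 n' = 0} := by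
    ext p
    simp only [mem_preimage, mem_ofPred_eq, (hgp p).2]
  rw [h, hg.measure_preimage hm.nullMeasurableSet, hvol_apply hm]
  refine setLIntegral_measure_zero _ _ ?_
  set W : Submodule ℝ E3 := LinearMap.ker (EuclideanSpace.proj (𝕜 := ℝ) (0 : Fin 3) : E3 →L[ℝ] ℝ).toLinearMap
  have hW : lift ⁻¹' {p : H3 | lorentz p.1 n' = 0} = W := by
    ext x
    simp [W, lorentz, lift, hn', EuclideanSpace.inner_single_right]
  rw [hW]
  refine Measure.addHaar_submodule volume W fun htop => ?_
  have : EuclideanSpace.single (0 : Fin 3) (1 : ℝ) ∈ W := htop ▸ Submodule.mem_top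
  simp [W] at this

/-! ### The volume of a sector of a ball -/

lemma lintegral_Ioc_of_hasDerivAt {g G : ℝ → ℝ} {a b : ℝ} (hab : a ≤ b) (hg : Continuous g)
    (h0 : ∀ s ∈ Ioc a b, 0 ≤ g s) (hG : ∀ s, HasDerivAt G (g s) s) :
    ∫⁻ s in Ioc a b, ENNReal.ofReal (g s) = ENNReal.ofReal (G b - G a) := by
  rw [← intervalIntegral.integral_eq_sub_of_hasDerivAt (fun s _ => hG s)
    (hg.intervalIntegrable a b), intervalIntegral.integral_of_le hab,
    ofReal_integral_eq_lintegral_ofReal]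
  · exact (hg.intervalIntegrable a b).1
  · exact (ae_restrict_iff' measurableSet_Ioc).2 (Filter.Eventually.of_forall h0)

/-- The solid circular cone with apex `0` about the first coordinate axis, whose half-angle has
cosine `k`. -/
def solidCone (k : ℝ) : Set E3 := {x | k * ‖x‖ ≤ x 0}

/-- Split off the first coordinate of `E3`. -/
def splitFirst (x : E3) : ℝ × EuclideanSpace ℝ (Fin 2) :=
  (x 0, WithLp.toLp 2 fun i => x i.succ)

lemma measurePreserving_splitFirst : MeasurePreserving splitFirst := by
  have h1 := EuclideanSpace.volume_preserving_symm_measurableEquiv_toLp (Fin 3)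
  have h2 := volume_preserving_piFinSuccAbove (fun _ : Fin 3 => ℝ) 0
  have h3 := PiLp.volume_preserving_toLp (Fin 2)
  have h4 := (MeasurePreserving.id (volume : Measure ℝ)).prod h3
  exact h4.comp (h2.comp h1)

lemma norm_splitFirst (x : E3) : ‖x‖ ^ 2 = (splitFirst x).1 ^ 2 + ‖(splitFirst x).2‖ ^ 2 := by
  rw [EuclideanSpace.norm_sq_eq, EuclideanSpace.norm_sq_eq, Fin.sum_univ_succ]
  simp [splitFirst]

/-- The volume of the unit ball cut by a solid cone, by slicing orthogonally to the axis: the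
slices are discs of radius `s √(1 - k²) / k` for `s ≤ k`, and of radius `√(1 - s²)` beyond. -/
lemma volume_solidCone_inter_closedBall {k : ℝ} (hk : 0 < k) (hk1 : k ≤ 1) :
    volume (solidCone k ∩ Metric.closedBall 0 1) = ENNReal.ofReal (2 * π / 3 * (1 - k)) := by
  set B : Set (ℝ × EuclideanSpace ℝ (Fin 2)) :=
    {q | k * √(q.1 ^ 2 + ‖q.2‖ ^ 2) ≤ q.1 ∧ q.1 ^ 2 + ‖q.2‖ ^ 2 ≤ 1} with hB
  have hB1 : MeasurableSet {q : ℝ × EuclideanSpace ℝ (Fin 2) |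
      k * √(q.1 ^ 2 + ‖q.2‖ ^ 2) ≤ q.1} := measurableSet_le (by fun_prop) (by fun_prop)
  have hB2 : MeasurableSet {q : ℝ × EuclideanSpace ℝ (Fin 2) | q.1 ^ 2 + ‖q.2‖ ^ 2 ≤ 1} :=
    measurableSet_le (by fun_prop) (by fun_prop)
  have hBm : MeasurableSet B := hB1.inter hB2
  have hA : solidCone k ∩ Metric.closedBall 0 1 = splitFirst ⁻¹' B := by
    ext x
    have h1 : (x ∈ Metric.closedBall (0 : E3) 1) ↔ ‖x‖ ^ 2 ≤ 1 := by
      rw [mem_closedBall_zero_iff, sq_le_one_iff₀ (norm_nonneg x)]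
    rw [mem_inter_iff, h1]
    simp only [hB, mem_preimage, mem_ofPred_eq, ← norm_splitFirst, sqrt_sq (norm_nonneg x)]
    rfl
  have hm : 0 ≤ 1 - k ^ 2 := by nlinarith
  have hslice : ∀ s, volume (Prod.mk s ⁻¹' B)
      = (Ioc 0 k).indicator (fun s => ENNReal.ofReal (π * (1 - k ^ 2) / k ^ 2 * s ^ 2)) s
        + (Ioc k 1).indicator (fun s => ENNReal.ofReal (π * (1 - s ^ 2))) s := by
    intro s
    have hmem : ∀ y, y ∈ Prod.mk s ⁻¹' B ↔
        0 ≤ s ∧ k ^ 2 * ‖y‖ ^ 2 ≤ (1 - k ^ 2) * s ^ 2 ∧ ‖y‖ ^ 2 ≤ 1 - s ^ 2 := by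
      intro y
      have hpos : 0 ≤ s ^ 2 + ‖y‖ ^ 2 := by positivity
      simp only [hB, mem_preimage, mem_ofPred_eq]
      constructor
      · rintro ⟨h1, h2⟩
        have h0 : 0 ≤ k * √(s ^ 2 + ‖y‖ ^ 2) := by positivity
        have h3 := pow_le_pow_left₀ h0 h1 2
        rw [mul_pow, sq_sqrt hpos] at h3
        exact ⟨h0.trans h1, by linarith, by linarith⟩
      · rintro ⟨h0, h1, h2⟩
        refine ⟨?_, by linarith⟩
        refine (le_abs_self _).trans (abs_le_of_sq_le_sq ?_ h0)
        rw [mul_pow, sq_sqrt hpos]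
        linarith
    have hdisc : ∀ h : ℝ, 0 ≤ h → volume (Metric.closedBall (0 : EuclideanSpace ℝ (Fin 2)) √h)
        = ENNReal.ofReal (π * h) := by
      intro h hh
      rw [EuclideanSpace.volume_closedBall_fin_two, ← ENNReal.ofReal_pow (sqrt_nonneg _),
        sq_sqrt hh, ← ENNReal.ofReal_mul hh, mul_comm]
    have hball : ∀ (h : ℝ) (y : EuclideanSpace ℝ (Fin 2)), 0 ≤ h →
        (y ∈ Metric.closedBall 0 √h ↔ ‖y‖ ^ 2 ≤ h) := by
      intro h y hh
      rw [mem_closedBall_zero_iff, le_sqrt (norm_nonneg y) hh]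
    rcases lt_or_ge s 0 with hs | hs
    · have : Prod.mk s ⁻¹' B = ∅ := by
        ext y; rw [hmem]
        exact iff_of_false (fun h => absurd h.1 (not_le.2 hs)) (notMem_empty _)
      rw [this, indicator_of_notMem (fun h => by linarith [h.1]),
        indicator_of_notMem (fun h => by linarith [h.1])]
      simp
    rcases le_or_gt s k with hsk | hsk
    · have h0 : 0 ≤ (1 - k ^ 2) / k ^ 2 * s ^ 2 := by positivity
      have : Prod.mk s ⁻¹' B = Metric.closedBall 0 √((1 - k ^ 2) / k ^ 2 * s ^ 2) := by
        ext y; rw [hmem, hball _ _ h0]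
        have h3 : ‖y‖ ^ 2 ≤ (1 - k ^ 2) / k ^ 2 * s ^ 2 ↔ k ^ 2 * ‖y‖ ^ 2 ≤ (1 - k ^ 2) * s ^ 2 := by
          rw [div_mul_eq_mul_div, le_div_iff₀ (by positivity), mul_comm]
        rw [h3]
        refine ⟨fun h => h.2.1, fun h => ⟨hs, h, ?_⟩⟩
        have h4 : (1 - k ^ 2) * s ^ 2 ≤ k ^ 2 * (1 - s ^ 2) := by nlinarith
        exact le_of_mul_le_mul_left (h.trans h4) (by positivity)
      rw [this, hdisc _ h0, indicator_of_notMem (fun h => by linarith [h.1] : s ∉ Ioc k 1), add_zero]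
      rcases eq_or_lt_of_le hs with rfl | hs0
      · rw [indicator_of_notMem (fun h => lt_irrefl _ h.1)]; simp
      · rw [indicator_of_mem (show s ∈ Ioc 0 k from ⟨hs0, hsk⟩)]; congr 1; ring
    rw [indicator_of_notMem (fun h => by linarith [h.2] : s ∉ Ioc 0 k), zero_add]
    rcases le_or_gt s 1 with hs1 | hs1
    · have h0 : 0 ≤ 1 - s ^ 2 := by nlinarith
      have : Prod.mk s ⁻¹' B = Metric.closedBall 0 √(1 - s ^ 2) := by
        ext y; rw [hmem, hball _ _ h0]
        refine ⟨fun h => h.2.2, fun h => ⟨hs, ?_, h⟩⟩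
        have h4 : k ^ 2 * (1 - s ^ 2) ≤ (1 - k ^ 2) * s ^ 2 := by nlinarith
        exact (mul_le_mul_of_nonneg_left h (sq_nonneg k)).trans h4
      rw [this, hdisc _ h0, indicator_of_mem (show s ∈ Ioc k 1 from ⟨hsk, hs1⟩)]
    · have : Prod.mk s ⁻¹' B = ∅ := by
        ext y; rw [hmem]
        refine iff_of_false (fun h => ?_) (notMem_empty _)
        nlinarith [h.2.2, sq_nonneg ‖y‖]
      rw [this, indicator_of_notMem (fun h => by linarith [h.2])]
      simp
  rw [hA, measurePreserving_splitFirst.measure_preimage hBm.nullMeasurableSet,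
    Measure.volume_eq_prod, Measure.prod_apply hBm]
  simp only [hslice]
  rw [lintegral_add_left (Measurable.indicator (by fun_prop) measurableSet_Ioc),
    lintegral_indicator measurableSet_Ioc, lintegral_indicator measurableSet_Ioc,
    lintegral_Ioc_of_hasDerivAt (g := fun s => π * (1 - k ^ 2) / k ^ 2 * s ^ 2)
      (G := fun s => π * (1 - k ^ 2) / k ^ 2 * (s ^ 3 / 3)) hk.le
      (by fun_prop) (fun s _ => by positivity)
      (fun s => by
        refine (((hasDerivAt_pow 3 s).div_const 3).const_mul _).congr_deriv ?_
        push_cast; ring),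
    lintegral_Ioc_of_hasDerivAt (g := fun s => π * (1 - s ^ 2))
      (G := fun s => π * (s - s ^ 3 / 3)) hk1
      (by fun_prop) (fun s hs => mul_nonneg pi_pos.le (by nlinarith [hs.1, hs.2]))
      (fun s => by
        refine (((hasDerivAt_id' s).sub ((hasDerivAt_pow 3 s).div_const 3)).const_mul _).congr_deriv ?_
        push_cast; ring),
    ← ENNReal.ofReal_add]
  · congr 1; field_simp; ring
  · have : 0 ≤ π * (1 - k ^ 2) / k ^ 2 * (k ^ 3 / 3) := by positivity
    simpa using this
  · have h1 : 0 ≤ (1 - k) ^ 2 * (2 + k) := by positivity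
    have h2 : π * (1 - 1 ^ 3 / 3) - π * (k - k ^ 3 / 3) = π * ((1 - k) ^ 2 * (2 + k) / 3) := by ring
    rw [h2]; positivity

lemma volume_solidCone_inter_closedBall_radius {k : ℝ} (hk : 0 < k) (hk1 : k ≤ 1) {R : ℝ}
    (hR : 0 ≤ R) : volume (solidCone k ∩ Metric.closedBall 0 R)
      = ENNReal.ofReal (2 * π / 3 * (1 - k) * R ^ 3) := by
  rcases eq_or_lt_of_le hR with rfl | hpos
  · rw [Metric.closedBall_zero]
    have : volume (solidCone k ∩ {0}) ≤ volume ({0} : Set E3) := measure_mono inter_subset_right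
    simpa using this
  · have h : solidCone k ∩ Metric.closedBall 0 R
        = R • (solidCone k ∩ Metric.closedBall (0 : E3) 1) := by
      ext x
      rw [mem_smul_set_iff_inv_smul_mem₀ hpos.ne']
      simp only [solidCone, mem_inter_iff, mem_ofPred_eq, mem_closedBall_zero_iff, norm_smul,
        norm_inv, norm_eq_abs, abs_of_pos hpos, PiLp.smul_apply, smul_eq_mul]
      rw [inv_mul_le_iff₀ hpos, mul_one, mul_left_comm, mul_le_mul_iff_right₀ (inv_pos.2 hpos)]
    rw [h, Measure.addHaar_smul, volume_solidCone_inter_closedBall hk hk1, finrank_euclideanSpace,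
      Fintype.card_fin, abs_of_pos (pow_pos hpos 3), ← ENNReal.ofReal_mul (by positivity), mul_comm]

/-- Integration of a radial function over a sector of a ball: the push-forward of the volume under
the norm has a quadratic density. -/
lemma lintegral_norm_solidCone {k : ℝ} (hk : 0 < k) (hk1 : k ≤ 1) {R : ℝ} (hR : 0 ≤ R)
    {f : ℝ → ENNReal} (hf : Measurable f) :
    ∫⁻ x in solidCone k ∩ Metric.closedBall 0 R, f ‖x‖
      = ∫⁻ s in Ioc 0 R, ENNReal.ofReal (2 * π * (1 - k) * s ^ 2) * f s := by
  set μ : Measure ℝ :=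
    (volume.restrict (solidCone k ∩ Metric.closedBall (0 : E3) R)).map fun x => ‖x‖ with hμ
  set ν : Measure ℝ := (volume.restrict (Ioc 0 R)).withDensity
    fun s => ENNReal.ofReal (2 * π * (1 - k) * s ^ 2) with hν
  have hfin : IsFiniteMeasure μ := by
    refine ⟨?_⟩
    rw [hμ, Measure.map_apply measurable_norm MeasurableSet.univ, preimage_univ,
      Measure.restrict_apply_univ, volume_solidCone_inter_closedBall_radius hk hk1 hR]
    exact ENNReal.ofReal_lt_top
  have hμν : μ = ν := by
    refine Measure.ext_of_Iic μ ν fun a => ?_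
    rw [hμ, hν, Measure.map_apply measurable_norm measurableSet_Iic,
      Measure.restrict_apply (measurable_norm measurableSet_Iic),
      withDensity_apply _ measurableSet_Iic, Measure.restrict_restrict measurableSet_Iic]
    have e1 : (fun x : E3 => ‖x‖) ⁻¹' Iic a ∩ (solidCone k ∩ Metric.closedBall 0 R)
        = solidCone k ∩ Metric.closedBall 0 (min a R) := by
      ext x
      simp only [mem_inter_iff, mem_preimage, mem_Iic, mem_closedBall_zero_iff, le_min_iff]
      tauto
    have e2 : Iic a ∩ Ioc 0 R = Ioc 0 (min a R) := by
      ext s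
      simp only [mem_inter_iff, mem_Iic, mem_Ioc, le_min_iff]
      tauto
    rw [e1, e2]
    rcases lt_or_ge a 0 with ha | ha
    · have h1 : min a R < 0 := min_lt_of_left_lt ha
      rw [Metric.closedBall_eq_empty.2 h1, Ioc_eq_empty (not_lt.2 h1.le)]
      simp
    · have h1 : 0 ≤ min a R := le_min ha hR
      rw [volume_solidCone_inter_closedBall_radius hk hk1 h1,
        lintegral_Ioc_of_hasDerivAt (g := fun s => 2 * π * (1 - k) * s ^ 2)
          (G := fun s => 2 * π / 3 * (1 - k) * s ^ 3) h1
          (by fun_prop) (fun s _ => by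
            have : 0 ≤ 1 - k := by linarith
            positivity)
          (fun s => by
            refine ((hasDerivAt_pow 3 s).const_mul _).congr_deriv ?_
            push_cast; ring)]
      simp
  calc _ = ∫⁻ s, f s ∂μ := (lintegral_map hf measurable_norm).symm
    _ = _ := by
      rw [hμν, hν, lintegral_withDensity_eq_lintegral_mul _ (by fun_prop) hf]
      rfl

/-- The hyperbolic volume, in the chart, of a sector of the ball of radius `a` about `origin`. -/
lemma lintegral_density_solidCone {k : ℝ} (hk : 0 < k) (hk1 : k ≤ 1) {a : ℝ} (ha : 0 ≤ a) :
    ∫⁻ x in solidCone k ∩ Metric.closedBall 0 (sinh a), ENNReal.ofReal (√(1 + ‖x‖ ^ 2))⁻¹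
      = ENNReal.ofReal (ballVol a / 2 * (1 - k)) := by
  have hpos : ∀ s : ℝ, (0:ℝ) < 1 + s ^ 2 := fun s => by positivity
  have hne : ∀ s : ℝ, √(1 + s ^ 2) ≠ 0 := fun s => (sqrt_pos.2 (hpos s)).ne'
  have hk' : 0 ≤ 1 - k := by linarith
  rw [lintegral_norm_solidCone hk hk1 (sinh_nonneg_iff.2 ha)
    (f := fun s => ENNReal.ofReal (√(1 + s ^ 2))⁻¹) (by fun_prop)]
  have e : ∀ s : ℝ, ENNReal.ofReal (2 * π * (1 - k) * s ^ 2) * ENNReal.ofReal (√(1 + s ^ 2))⁻¹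
      = ENNReal.ofReal (2 * π * (1 - k) * s ^ 2 * (√(1 + s ^ 2))⁻¹) := fun s =>
    (ENNReal.ofReal_mul (by positivity)).symm
  simp only [e]
  rw [lintegral_Ioc_of_hasDerivAt
    (g := fun s => 2 * π * (1 - k) * s ^ 2 * (√(1 + s ^ 2))⁻¹)
    (G := fun s => π * (1 - k) * (s * √(1 + s ^ 2) - arsinh s)) (sinh_nonneg_iff.2 ha)
    (Continuous.mul (by fun_prop) (Continuous.inv₀ (by fun_prop) hne))
    (fun s _ => by positivity)]
  · congr 1
    have h1 : √(1 + sinh a ^ 2) = cosh a := by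
      rw [add_comm, ← cosh_sq, sqrt_sq (cosh_pos a).le]
    rw [h1, arsinh_sinh, ballVol, sinh_two_mul]
    simp
    ring
  · intro s
    have h1 : HasDerivAt (fun s : ℝ => 1 + s ^ 2) (2 * s) s := by
      simpa using ((hasDerivAt_id s).pow 2).const_add 1
    refine ((((hasDerivAt_id' s).mul (h1.sqrt (hpos s).ne')).sub
      (hasDerivAt_arsinh s)).const_mul _).congr_deriv ?_
    have h3 := sq_sqrt (hpos s).le
    have h4 := hne s
    field_simp
    rw [h3]
    ring

/-- The volume of a sector of the ball of radius `a` about `T`; the half-angle at `T`, around the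
axis in direction `e`, has cosine `k`. -/
lemma hvol_sector {T : H3} {e : ℝ × E3} (he : lorentz e e = 1) (hTe : lorentz T.1 e = 0)
    {k : ℝ} (hk : 0 < k) (hk1 : k ≤ 1) {a : ℝ} (ha : 0 ≤ a) :
    hvol.real {p : H3 | k * √(lorentz p.1 T.1 ^ 2 - 1) ≤ lorentz p.1 e ∧
      -lorentz p.1 T.1 ≤ cosh a} = ballVol a / 2 * (1 - k) := by
  set n' : ℝ × E3 := (0, EuclideanSpace.single 0 1) with hn'
  have h1 : lorentz n' n' = 1 := by
    rw [lorentz_self, hn']; simp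
  obtain ⟨g, hg, hgp⟩ := exists_isometry T (n := e) (n' := n') (by rw [he, h1])
    (by rw [lorentz_comm, hTe, lorentz_origin, hn', neg_zero])
  set A : Set H3 := {p : H3 | k * √(lorentz p.1 origin.1 ^ 2 - 1) ≤ lorentz p.1 n' ∧
      -lorentz p.1 origin.1 ≤ cosh a} with hA
  have hm : MeasurableSet A := by
    refine MeasurableSet.inter (measurableSet_le ?_ (measurable_lorentz_right _))
      (measurableSet_origin_ball _)
    exact (((measurable_lorentz_right _).pow_const 2).sub_const 1).sqrt.const_mul k
  have h : {p : H3 | k * √(lorentz p.1 T.1 ^ 2 - 1) ≤ lorentz p.1 e ∧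
      -lorentz p.1 T.1 ≤ cosh a} = g ⁻¹' A := by
    ext p
    simp only [hA, mem_preimage, mem_ofPred_eq, (hgp p).1, (hgp p).2]
  have hchart : lift ⁻¹' A = solidCone k ∩ Metric.closedBall 0 (sinh a) := by
    ext x
    have hx1 : (lift x).1.1 = √(1 + ‖x‖ ^ 2) := rfl
    have hx2 : lorentz (lift x).1 n' = x 0 := by
      simp [lorentz, lift, hn', EuclideanSpace.inner_single_right]
    simp only [hA, mem_preimage, mem_ofPred_eq, lorentz_origin, hx1, hx2, neg_sq, neg_neg,
      sq_sqrt (show (0:ℝ) ≤ 1 + ‖x‖ ^ 2 by positivity), add_sub_cancel_left,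
      sqrt_sq (norm_nonneg x), mem_inter_iff, mem_closedBall_zero_iff, solidCone]
    refine and_congr_right fun _ => ?_
    rw [sqrt_le_left (cosh_pos a).le, cosh_sq, add_comm 1, add_le_add_iff_right,
      sq_le_sq₀ (norm_nonneg x) (sinh_nonneg_iff.2 ha)]
  have hB : 0 ≤ ballVol a := by
    have := self_le_sinh_iff.2 (show 0 ≤ 2 * a by linarith)
    exact mul_nonneg pi_pos.le (by linarith)
  rw [h, measureReal_def, hg.measure_preimage hm.nullMeasurableSet, hvol_apply' hm, hchart,
    lintegral_density_solidCone hk hk1 ha, ENNReal.toReal_ofReal]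
  have : 0 ≤ 1 - k := by linarith
  positivity

/-! ### Planes orthogonal to the axis -/

/-- The unit normal of the plane which is orthogonal at signed distance `w` from `T` to the geodesic
through `T` with direction `e`. -/
def axisNormal (T : H3) (e : ℝ × E3) (w : ℝ) : ℝ × E3 := sinh w • T.1 + cosh w • e

section axis

variable {T Q : H3} {e : ℝ × E3}

lemma lorentz_axisNormal (p : ℝ × E3) (w : ℝ) :
    lorentz p (axisNormal T e w) = cosh w * lorentz p e - sinh w * -lorentz p T.1 := by
  rw [axisNormal, lorentz_add_right, lorentz_smul_right, lorentz_smul_right]; ring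

lemma axisNormal_self (he : lorentz e e = 1) (hTe : lorentz T.1 e = 0) (w : ℝ) :
    lorentz (axisNormal T e w) (axisNormal T e w) = 1 := by
  simp only [axisNormal, lorentz_add_right, lorentz_smul_right, lorentz_add_left,
    lorentz_smul_left, he, hTe, lorentz_comm e T.1, T.lorentz_self]
  linarith [cosh_sq w]

lemma axisNormal_apex (hTe : lorentz T.1 e = 0) (w : ℝ) :
    lorentz (axisNormal T e w) T.1 = -sinh w := by
  rw [lorentz_comm, lorentz_axisNormal, hTe, T.lorentz_self]; ring

lemma neg_axisNormal_center {D : ℝ} (he : lorentz e e = 1) (hTe : lorentz T.1 e = 0)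
    (hQ : Q.1 = cosh D • T.1 + sinh D • e) (w : ℝ) :
    lorentz (-axisNormal T e w) Q.1 = -sinh (D - w) := by
  rw [lorentz_neg_left, lorentz_comm, lorentz_axisNormal, hQ]
  simp only [lorentz_add_left, lorentz_smul_left, he, hTe, lorentz_comm e T.1, T.lorentz_self]
  rw [sinh_sub]; ring

lemma hvol_axisPlane (he : lorentz e e = 1) (hTe : lorentz T.1 e = 0) (w : ℝ) :
    hvol {p : H3 | lorentz p.1 (axisNormal T e w) = 0} = 0 := by
  have hx : lorentz (cosh w • T.1 + sinh w • e) (cosh w • T.1 + sinh w • e) = -1 := by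
    simp only [lorentz_add_right, lorentz_smul_right, lorentz_add_left,
      lorentz_smul_left, he, hTe, lorentz_comm e T.1, T.lorentz_self]
    linarith [cosh_sq w]
  have hxT : lorentz (cosh w • T.1 + sinh w • e) T.1 < 0 := by
    simp only [lorentz_add_left, lorentz_smul_left, hTe, lorentz_comm e T.1, T.lorentz_self]
    linarith [cosh_pos w]
  refine hvol_plane (c := ⟨cosh w • T.1 + sinh w • e, hx,
    (fst_pos_iff_lorentz_neg T (by rw [hx]; norm_num)).2 hxT⟩)
    (axisNormal_self he hTe w) ?_
  rw [lorentz_comm, lorentz_axisNormal]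
  simp only [lorentz_add_left, lorentz_smul_left, he, hTe, lorentz_comm e T.1, T.lorentz_self]
  ring

lemma lorentz_center {D : ℝ} (hQ : Q.1 = cosh D • T.1 + sinh D • e) (p : H3) :
    -lorentz p.1 Q.1 = cosh D * -lorentz p.1 T.1 - sinh D * lorentz p.1 e := by
  rw [hQ, lorentz_add_right, lorentz_smul_right, lorentz_smul_right]; ring

/-! ### The lens -/

lemma eta_nonneg {ρ r D : ℝ} (h₁ : r < D) (h₂ : D < ρ) (h₃ : ρ < D + r) :
    0 ≤ eta ρ r D := by
  have h1 : cosh (ρ - r) ≤ cosh D := by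
    rw [cosh_le_cosh, abs_of_pos (by linarith), abs_of_pos (by linarith)]; linarith
  have h2 : cosh D ≤ cosh (ρ + r) := by
    rw [cosh_le_cosh, abs_of_pos (by linarith), abs_of_pos (by linarith)]; linarith
  rw [cosh_sub] at h1
  rw [cosh_add] at h2
  refine div_nonneg ?_ (sq_nonneg _)
  have h3 := sq_le_sq' (a := cosh D - cosh ρ * cosh r) (b := sinh ρ * sinh r) (by linarith)
    (by linarith)
  rw [mul_pow, sinh_sq, sinh_sq] at h3
  linarith

/-- The radical plane of the two spheres is orthogonal to the axis, at distance `σ` from `T`. -/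
lemma sigma_spec {ρ r D : ℝ} (hD : 0 < D) (hη : 0 ≤ eta ρ r D) (hρ : cosh r ≤ cosh ρ * cosh D) :
    cosh ρ * sinh D * sinh (sigma ρ r D) = (cosh ρ * cosh D - cosh r) * cosh (sigma ρ r D) := by
  have hS : 0 < sinh D := sinh_pos_iff.2 hD
  have hη1 : 0 < 1 + eta ρ r D := by linarith
  have hq : 0 < √(1 + eta ρ r D) := sqrt_pos.2 hη1
  have hX : (1 + eta ρ r D) * sinh D ^ 2
      = 2 * cosh ρ * cosh r * cosh D - cosh ρ ^ 2 - cosh r ^ 2 := by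
    rw [eta]; field_simp; linarith [cosh_sq D]
  have hge : 1 ≤ cosh ρ / √(1 + eta ρ r D) := by
    rw [one_le_div hq, sqrt_le_left (cosh_pos ρ).le]
    refine le_of_mul_le_mul_right ?_ (pow_pos hS 2)
    rw [hX, sinh_sq]
    nlinarith [sq_nonneg (cosh ρ * cosh D - cosh r)]
  have hc : cosh (sigma ρ r D) = cosh ρ / √(1 + eta ρ r D) := cosh_arcosh hge
  have hs : 0 ≤ sinh (sigma ρ r D) := sinh_nonneg_iff.2 (arcosh_nonneg hge)
  have hc2 : cosh (sigma ρ r D) ^ 2 * (1 + eta ρ r D) = cosh ρ ^ 2 := by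
    rw [hc, div_pow, sq_sqrt hη1.le]; field_simp
  have hs2 := sinh_sq (sigma ρ r D)
  have hρ0 := cosh_pos ρ
  rw [← sq_eq_sq₀ (by positivity) (mul_nonneg (by linarith) (cosh_pos _).le)]
  have hk : cosh ρ ^ 2 * (sinh D ^ 2 - (cosh ρ * cosh D - cosh r) ^ 2 / cosh ρ ^ 2)
      = (1 + eta ρ r D) * sinh D ^ 2 := by
    rw [hX]; field_simp; rw [sinh_sq]; ring
  refine mul_right_cancel₀ hη1.ne' ?_
  have hk2 : cosh ρ ^ 2 * sinh D ^ 2 - (cosh ρ * cosh D - cosh r) ^ 2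
      = (1 + eta ρ r D) * sinh D ^ 2 := by rw [← hk]; field_simp
  rw [mul_pow, mul_pow, mul_pow, hs2]
  linear_combination (cosh ρ ^ 2 * sinh D ^ 2 - (cosh ρ * cosh D - cosh r) ^ 2) * hc2
    + cosh ρ ^ 2 * hk2

/-- The radical plane cuts the intersection of two balls into a cap of each: the cap of the ball
about `T` on the far side of the plane from `T`, and the cap of the ball about `Q` on the other
side. -/
lemma hvol_lens {D ρ r : ℝ} (he : lorentz e e = 1) (hTe : lorentz T.1 e = 0)
    (hQ : Q.1 = cosh D • T.1 + sinh D • e) (hr : 0 < r) (hD : 0 < D) (hρ : 0 < ρ)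
    (hη : 0 ≤ eta ρ r D) (hρr : cosh r ≤ cosh ρ * cosh D) :
    hvol.real (hclosedBall Q r ∩ hclosedBall T ρ) = lensVol ρ r D := by
  have hσ := sigma_spec hD hη hρr
  set σ := sigma ρ r D with hσdef
  have hR := cosh_pos ρ
  have hch := cosh_pos σ
  have hc := cosh_pos r
  have hS : 0 < sinh D := sinh_pos_iff.2 hD
  have hball : ∀ p : H3, p ∈ hclosedBall Q r ↔
      cosh D * -lorentz p.1 T.1 - sinh D * lorentz p.1 e ≤ cosh r := fun p => by
    rw [mem_hclosedBall_iff _ _ hr.le, lorentz_center hQ]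
  -- multiplying by `cosh ρ sinh D` turns the half-space inequality into one without `σ`
  have hhalf : ∀ a t : ℝ, cosh ρ * sinh D * (cosh σ * t - sinh σ * a)
      = cosh σ * (cosh r * a - cosh ρ * (cosh D * a - sinh D * t)) := fun a t => by
    linear_combination -a * hσ
  have hsplit : hclosedBall Q r ∩ hclosedBall T ρ
      = (hclosedBall T ρ ∩ {p : H3 | 0 ≤ lorentz p.1 (axisNormal T e σ)})
        ∪ (hclosedBall Q r ∩ {p : H3 | 0 ≤ lorentz p.1 (-axisNormal T e σ)}) := by
    ext p
    simp only [mem_inter_iff, mem_union, mem_ofPred_eq, hball, mem_hclosedBall_iff p T hρ.le,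
      lorentz_neg_right, lorentz_axisNormal]
    have h := hhalf (-lorentz p.1 T.1) (lorentz p.1 e)
    set a := -lorentz p.1 T.1
    set t := lorentz p.1 e
    have hRS : 0 < cosh ρ * sinh D := by positivity
    constructor
    · rintro ⟨h1, h2⟩
      rcases le_total 0 (cosh σ * t - sinh σ * a) with h3 | h3
      · exact Or.inl ⟨h2, h3⟩
      · exact Or.inr ⟨h1, by linarith⟩
    · rintro (⟨h1, h2⟩ | ⟨h1, h2⟩)
      · refine ⟨?_, h1⟩
        have h3 : 0 ≤ cosh σ * (cosh r * a - cosh ρ * (cosh D * a - sinh D * t)) := by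
          rw [← h]; positivity
        have h4 := nonneg_of_mul_nonneg_right h3 hch
        refine le_of_mul_le_mul_left ?_ hR
        nlinarith
      · refine ⟨h1, ?_⟩
        have h3 : 0 ≤ cosh σ * -(cosh r * a - cosh ρ * (cosh D * a - sinh D * t)) := by
          rw [mul_neg, ← h, ← mul_neg]; positivity
        have h4 := nonneg_of_mul_nonneg_right h3 hch
        refine le_of_mul_le_mul_left ?_ hc
        nlinarith
  have hn := axisNormal_self (T := T) he hTe σ
  have hn' : lorentz (-axisNormal T e σ) (-axisNormal T e σ) = 1 := by
    rw [lorentz_neg_left, lorentz_neg_right, hn, neg_neg]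
  rw [hsplit, measureReal_union₀ ?_ ?_ ?_ ?_, hvol_hclosedBall_inter_halfSpace T hρ.le hn
    (axisNormal_apex hTe σ), hvol_hclosedBall_inter_halfSpace Q hr.le hn'
    (neg_axisNormal_center he hTe hQ σ), lensVol]
  · exact ((measurableSet_hclosedBall Q hr.le).inter (measurableSet_halfSpace _)).nullMeasurableSet
  · refine measure_mono_null (fun p hp => ?_) (hvol_axisPlane he hTe σ)
    have h1 : 0 ≤ lorentz p.1 (axisNormal T e σ) := hp.1.2
    have h2 : 0 ≤ lorentz p.1 (-axisNormal T e σ) := hp.2.2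
    rw [lorentz_neg_right] at h2
    exact le_antisymm (by linarith) h1
  · exact measure_ne_top_of_subset inter_subset_left (hvol_hclosedBall_ne_top T hρ.le)
  · exact measure_ne_top_of_subset inter_subset_left (hvol_hclosedBall_ne_top Q hr.le)

/-! ### The truncated tangent cone -/

/-- The tangent cone with apex `T` of the ball of radius `r` about the point at distance `D` from
`T` in direction `e`, truncated by the plane through the circle of tangency. -/
def truncatedCone (T : H3) (e : ℝ × E3) (r D : ℝ) : Set H3 :=
  {p | 0 ≤ lorentz p.1 e ∧
    (sinh D ^ 2 - sinh r ^ 2) * (lorentz p.1 T.1 ^ 2 - 1) ≤ sinh D ^ 2 * lorentz p.1 e ^ 2 ∧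
    sinh D * cosh D * lorentz p.1 e ≤ (sinh D ^ 2 - sinh r ^ 2) * -lorentz p.1 T.1}

lemma measurableSet_truncatedCone (r D : ℝ) : MeasurableSet (truncatedCone T e r D) := by
  have hT := measurable_lorentz_right T.1
  have he := measurable_lorentz_right e
  have h1 : MeasurableSet {p : H3 | 0 ≤ lorentz p.1 e} := measurableSet_halfSpace e
  have h2 : MeasurableSet {p : H3 | (sinh D ^ 2 - sinh r ^ 2) * (lorentz p.1 T.1 ^ 2 - 1)
      ≤ sinh D ^ 2 * lorentz p.1 e ^ 2} :=
    measurableSet_le (((hT.pow_const 2).sub_const 1).const_mul _) ((he.pow_const 2).const_mul _)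
  have h3 : MeasurableSet {p : H3 | sinh D * cosh D * lorentz p.1 e
      ≤ (sinh D ^ 2 - sinh r ^ 2) * -lorentz p.1 T.1} :=
    measurableSet_le (he.const_mul _) (hT.neg.const_mul _)
  exact h1.inter (h2.inter h3)

lemma cosh_omega {r D : ℝ} (hr : 0 < r) (hD : r < D) : cosh (omega r D) = cosh D / cosh r ∧
    0 < omega r D := by
  have h1 : 1 < cosh D / cosh r := by
    rw [one_lt_div (cosh_pos r), cosh_lt_cosh, abs_of_pos hr, abs_of_pos (hr.trans hD)]; exact hD
  exact ⟨cosh_arcosh h1.le, arcosh_pos h1⟩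

/-- The circle of tangency lies in the plane orthogonal to the axis at distance `ψ(ω, θ)` from
`T`. -/
lemma psi_spec {r D : ℝ} (hr : 0 < r) (hD : r < D) :
    sinh D * cosh D * sinh (psi (omega r D) (theta r D))
      = (sinh D ^ 2 - sinh r ^ 2) * cosh (psi (omega r D) (theta r D)) := by
  have hS : 0 < sinh D := sinh_pos_iff.2 (hr.trans hD)
  have hs : 0 < sinh r := sinh_pos_iff.2 hr
  have hsS : sinh r < sinh D := sinh_lt_sinh.2 hD
  have hω := (cosh_omega hr hD).1
  have hsin : sin (theta r D) = sinh r / sinh D :=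
    sin_arcsin (by have : 0 < sinh r / sinh D := by positivity
                   linarith) ((div_le_one hS).2 hsS.le)
  have hω2 : sinh (omega r D) ^ 2 = cosh D ^ 2 / cosh r ^ 2 - 1 := by
    rw [sinh_sq, hω, div_pow]
  have hc := cosh_pos r
  have hC := cosh_pos D
  have hC2 := cosh_sq D
  have hc2 := cosh_sq r
  set Y := 1 + sinh (omega r D) ^ 2 * sin (theta r D) ^ 2 with hY
  have hYpos : 0 < Y := by positivity
  have hge : 1 ≤ cosh (omega r D) / √Y := by
    rw [one_le_div (sqrt_pos.2 hYpos), sqrt_le_left (cosh_pos _).le, cosh_sq, hY]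
    nlinarith [sin_sq_le_one (theta r D), sq_nonneg (sinh (omega r D))]
  have hψ : cosh (psi (omega r D) (theta r D)) = cosh (omega r D) / √Y := cosh_arcosh hge
  have hψs : 0 ≤ sinh (psi (omega r D) (theta r D)) := sinh_nonneg_iff.2 (arcosh_nonneg hge)
  have hsh := sinh_sq (psi (omega r D) (theta r D))
  have h1 : cosh (psi (omega r D) (theta r D)) ^ 2 * Y = cosh D ^ 2 / cosh r ^ 2 := by
    rw [hψ, div_pow, sq_sqrt hYpos.le, hω, div_pow]; field_simp
  have hY2 : Y * (cosh r ^ 2 * sinh D ^ 2)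
      = sinh D ^ 2 * cosh D ^ 2 - (sinh D ^ 2 - sinh r ^ 2) ^ 2 := by
    rw [hY, hω2, hsin]; field_simp; rw [hC2, hc2]; ring
  have h2 : cosh (psi (omega r D) (theta r D)) ^ 2
      * (sinh D ^ 2 * cosh D ^ 2 - (sinh D ^ 2 - sinh r ^ 2) ^ 2) = sinh D ^ 2 * cosh D ^ 2 := by
    rw [← hY2, ← mul_assoc, h1]; field_simp
  have hΔ : 0 ≤ sinh D ^ 2 - sinh r ^ 2 := by nlinarith
  rw [← sq_eq_sq₀ (by positivity) (mul_nonneg hΔ (cosh_pos _).le), mul_pow, mul_pow, mul_pow, hsh]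
  linear_combination h2

lemma truncatedCone_subset {r D : ℝ} (hr : 0 < r) (hD : r < D) {p : H3}
    (hp : p ∈ truncatedCone T e r D) : p ∈ hclosedBall T (omega r D) := by
  obtain ⟨ht, h1, h2⟩ := hp
  obtain ⟨hω, hω0⟩ := cosh_omega hr hD
  have hS : 0 < sinh D := sinh_pos_iff.2 (hr.trans hD)
  have hs : 0 < sinh r := sinh_pos_iff.2 hr
  have hsS : sinh r < sinh D := sinh_lt_sinh.2 hD
  have hC := cosh_pos D
  have hΔ : 0 < sinh D ^ 2 - sinh r ^ 2 := by nlinarith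
  rw [mem_hclosedBall_iff _ _ hω0.le, hω, le_div_iff₀ (cosh_pos r)]
  refine (le_abs_self _).trans (abs_le_of_sq_le_sq ?_ hC.le)
  rw [← neg_sq (lorentz p.1 T.1)] at h1
  set a := -lorentz p.1 T.1
  set t := lorentz p.1 e
  have h3 := pow_le_pow_left₀ (by positivity) h2 2
  have h4 : (sinh D ^ 2 - sinh r ^ 2) * (cosh D ^ 2 * (a ^ 2 - 1))
      ≤ (sinh D ^ 2 - sinh r ^ 2) * ((sinh D ^ 2 - sinh r ^ 2) * a ^ 2) := by
    have := mul_le_mul_of_nonneg_left h1 (sq_nonneg (cosh D))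
    linarith
  have h5 := le_of_mul_le_mul_left h4 hΔ
  rw [cosh_sq D] at h5 ⊢
  rw [mul_pow, cosh_sq r]
  linarith

/-- The truncated cone and the cap beyond its base of the ball of radius `ω` about `T` make up a
sector of that ball. -/
lemma hvol_truncatedCone {r D : ℝ} (he : lorentz e e = 1) (hTe : lorentz T.1 e = 0) (hr : 0 < r)
    (hD : r < D) :
    hvol.real (truncatedCone T e r D) = coneVol (omega r D) (theta r D) := by
  obtain ⟨hω, hω0⟩ := cosh_omega hr hD
  have hS : 0 < sinh D := sinh_pos_iff.2 (hr.trans hD)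
  have hs : 0 < sinh r := sinh_pos_iff.2 hr
  have hsS : sinh r < sinh D := sinh_lt_sinh.2 hD
  have hC := cosh_pos D
  have hc := cosh_pos r
  have hΔ : 0 < sinh D ^ 2 - sinh r ^ 2 := by nlinarith
  have hC2 := cosh_sq D
  have hc2 := cosh_sq r
  have hψ := psi_spec hr hD
  set ψ := psi (omega r D) (theta r D) with hψdef
  have hk : cos (theta r D) = √(1 - (sinh r / sinh D) ^ 2) := cos_arcsin _
  have hquot : (sinh r / sinh D) ^ 2 < 1 := by
    rw [div_pow, div_lt_one (by positivity)]; linarith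
  have hkpos : 0 < cos (theta r D) := by rw [hk]; exact sqrt_pos.2 (by linarith)
  have hk2 : cos (theta r D) ^ 2 * sinh D ^ 2 = sinh D ^ 2 - sinh r ^ 2 := by
    rw [hk, sq_sqrt (by linarith)]; field_simp
  set k := cos (theta r D) with hkdef
  have hhalf : ∀ a t : ℝ, sinh D * cosh D * (cosh ψ * t - sinh ψ * a)
      = cosh ψ * (sinh D * cosh D * t - (sinh D ^ 2 - sinh r ^ 2) * a) := fun a t => by
    linear_combination -a * hψ
  have hSC : 0 < sinh D * cosh D := by positivity
  have hhalf' : ∀ a t : ℝ, 0 ≤ cosh ψ * t - sinh ψ * a ↔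
      (sinh D ^ 2 - sinh r ^ 2) * a ≤ sinh D * cosh D * t := fun a t => by
    rw [← mul_nonneg_iff_of_pos_left hSC, hhalf, mul_nonneg_iff_of_pos_left (cosh_pos ψ),
      sub_nonneg]
  have hcone : ∀ p : H3, k * √(lorentz p.1 T.1 ^ 2 - 1) ≤ lorentz p.1 e ↔
      0 ≤ lorentz p.1 e ∧ (sinh D ^ 2 - sinh r ^ 2) * (lorentz p.1 T.1 ^ 2 - 1)
        ≤ sinh D ^ 2 * lorentz p.1 e ^ 2 := fun p => by
    have h0 : 0 ≤ lorentz p.1 T.1 ^ 2 - 1 := by nlinarith [one_le_neg_lorentz p T]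
    have hsq : (sinh D ^ 2 - sinh r ^ 2) * (lorentz p.1 T.1 ^ 2 - 1)
        ≤ sinh D ^ 2 * lorentz p.1 e ^ 2 ↔
        (k * √(lorentz p.1 T.1 ^ 2 - 1)) ^ 2 ≤ lorentz p.1 e ^ 2 := by
      rw [← hk2, mul_pow, sq_sqrt h0, mul_comm (k ^ 2), mul_assoc,
        mul_le_mul_iff_right₀ (by positivity)]
    rw [hsq]
    have hl : 0 ≤ k * √(lorentz p.1 T.1 ^ 2 - 1) := by positivity
    refine ⟨fun h => ⟨hl.trans h, pow_le_pow_left₀ hl h 2⟩, fun h => ?_⟩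
    exact (le_abs_self _).trans (abs_le_of_sq_le_sq h.2 h.1)
  have hsplit : {p : H3 | k * √(lorentz p.1 T.1 ^ 2 - 1) ≤ lorentz p.1 e ∧
        -lorentz p.1 T.1 ≤ cosh (omega r D)}
      = truncatedCone T e r D
        ∪ (hclosedBall T (omega r D) ∩ {p : H3 | 0 ≤ lorentz p.1 (axisNormal T e ψ)}) := by
    ext p
    constructor
    · rintro ⟨h1, h2⟩
      obtain ⟨h3, h4⟩ := (hcone p).1 h1
      rcases le_total (sinh D * cosh D * lorentz p.1 e)
        ((sinh D ^ 2 - sinh r ^ 2) * -lorentz p.1 T.1) with h5 | h5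
      · exact Or.inl ⟨h3, h4, h5⟩
      · refine Or.inr ⟨(mem_hclosedBall_iff _ _ hω0.le).2 h2, ?_⟩
        change 0 ≤ lorentz p.1 (axisNormal T e ψ)
        rw [lorentz_axisNormal]
        exact (hhalf' _ _).2 h5
    · rintro (h | ⟨h1, h2⟩)
      · exact ⟨(hcone p).2 ⟨h.1, h.2.1⟩,
          (mem_hclosedBall_iff _ _ hω0.le).1 (truncatedCone_subset hr hD h)⟩
      · -- the cap of the ball of radius `ω` about `T` beyond the plane lies in the cone
        rw [mem_hclosedBall_iff _ _ hω0.le] at h1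
        change 0 ≤ lorentz p.1 (axisNormal T e ψ) at h2
        rw [lorentz_axisNormal, hhalf'] at h2
        refine ⟨(hcone p).2 ?_, h1⟩
        have ha := one_le_neg_lorentz p T
        rw [hω, le_div_iff₀ hc] at h1
        rw [← neg_sq (lorentz p.1 T.1)]
        set a := -lorentz p.1 T.1
        set t := lorentz p.1 e
        have hl : 0 ≤ (sinh D ^ 2 - sinh r ^ 2) * a := by positivity
        refine ⟨nonneg_of_mul_nonneg_right (hl.trans h2) hSC, ?_⟩
        have h3 := pow_le_pow_left₀ hl h2 2
        have h4 := pow_le_pow_left₀ (by positivity) h1 2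
        refine le_of_mul_le_mul_left ?_ (pow_pos hC 2)
        have h5 : cosh D ^ 2 * (a ^ 2 - 1) ≤ (sinh D ^ 2 - sinh r ^ 2) * a ^ 2 := by
          rw [mul_pow, hc2, hC2] at h4
          rw [hC2]; linarith
        have h6 := mul_le_mul_of_nonneg_left h5 hΔ.le
        linarith
  have hn := axisNormal_self (T := T) he hTe ψ
  have hsec := hvol_sector he hTe hkpos (cos_le_one (theta r D)) hω0.le
  rw [hsplit, measureReal_union₀ ?_ ?_ ?_ ?_, hvol_hclosedBall_inter_halfSpace T hω0.le hn
    (axisNormal_apex hTe ψ)] at hsec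
  · rw [coneVol]; linarith
  · exact ((measurableSet_hclosedBall T hω0.le).inter
      (measurableSet_halfSpace _)).nullMeasurableSet
  · refine measure_mono_null (fun p hp => ?_) (hvol_axisPlane he hTe ψ)
    have h1 : 0 ≤ lorentz p.1 (axisNormal T e ψ) := hp.2.2
    refine le_antisymm ?_ h1
    by_contra hc
    rw [lorentz_axisNormal] at hc
    have h2 := (mul_pos_iff_of_pos_left hSC).2 (not_le.1 hc)
    rw [hhalf, mul_pos_iff_of_pos_left (cosh_pos ψ)] at h2
    linarith [hp.1.2.2]
  · exact measure_ne_top_of_subset (fun p hp => truncatedCone_subset hr hD hp)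
      (hvol_hclosedBall_ne_top T hω0.le)
  · exact measure_ne_top_of_subset inter_subset_left (hvol_hclosedBall_ne_top T hω0.le)

/-- The part of the ball on the same side as `T` of the plane through the circle of tangency is the
part of the ball inside the truncated tangent cone. -/
lemma hclosedBall_inter_truncatedCone {r D : ℝ} (hQ : Q.1 = cosh D • T.1 + sinh D • e)
    (hr : 0 < r) (hD : r < D) :
    hclosedBall Q r ∩ truncatedCone T e r D = hclosedBall Q r ∩
      {p : H3 | 0 ≤ lorentz p.1 (-axisNormal T e (psi (omega r D) (theta r D)))} := by
  have hψ := psi_spec hr hD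
  set ψ := psi (omega r D) (theta r D)
  have hS : 0 < sinh D := sinh_pos_iff.2 (hr.trans hD)
  have hC := cosh_pos D
  have hSC : 0 < sinh D * cosh D := by positivity
  have hcC : cosh r < cosh D := by
    rw [cosh_lt_cosh, abs_of_pos hr, abs_of_pos (hr.trans hD)]; exact hD
  ext p
  refine and_congr_right fun hp => ?_
  rw [mem_hclosedBall_iff _ _ hr.le, lorentz_center hQ] at hp
  obtain ⟨h1, h2⟩ := tangentCone_of_ball hS (cosh_pos r) hcC (cosh_sq D) (cosh_sq r)
    (one_le_neg_lorentz p T) hp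
  rw [neg_sq] at h2
  have h3 : sinh D * cosh D * -lorentz p.1 (axisNormal T e ψ)
      = cosh ψ * ((sinh D ^ 2 - sinh r ^ 2) * -lorentz p.1 T.1
        - sinh D * cosh D * lorentz p.1 e) := by
    rw [lorentz_axisNormal]; linear_combination (-lorentz p.1 T.1) * hψ
  change _ ↔ 0 ≤ lorentz p.1 (-axisNormal T e ψ)
  rw [lorentz_neg_right, ← mul_nonneg_iff_of_pos_left hSC, h3,
    mul_nonneg_iff_of_pos_left (cosh_pos ψ), sub_nonneg]
  exact ⟨fun h => h.2.2, fun h => ⟨h1, h2, h⟩⟩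

end axis

end HypThree

end

open HypThree MeasureTheory in
theorem lemma3p8 (T Q : HypThree.H3) (D ρ r : ℝ) (hTQ : T ≠ Q)
    (hD : D = HypThree.hdist T Q) (hρ : 0 < ρ) (hr : 0 < r)
    (h₁ : r < D) (h₂ : D < ρ) (h₃ : ρ < D + r) :
    (ρ, r, D) ∈ HypThree.setVZero ∧
      HypThree.hvol (HypThree.hconvexHull ({T} ∪ HypThree.hclosedBall Q r)
        ∩ HypThree.hclosedBall T ρ) ≠ ⊤ ∧
      (HypThree.hvol (HypThree.hconvexHull ({T} ∪ HypThree.hclosedBall Q r)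
        ∩ HypThree.hclosedBall T ρ)).toReal = HypThree.phi ρ r D := by
  have hη := eta_nonneg h₁ h₂ h₃
  have hD0 : 0 < D := hr.trans h₁
  refine ⟨⟨⟨hρ, hr, hD0, hη⟩, h₁⟩, measure_ne_top_of_subset Set.inter_subset_right
    (hvol_hclosedBall_ne_top T hρ.le), ?_⟩
  obtain ⟨e, he, hTe, hQ⟩ := exists_unit_direction hTQ
  rw [← hD] at hQ
  obtain ⟨hω, hω0⟩ := cosh_omega hr h₁
  have hc1 := Real.one_le_cosh r
  have hC1 := Real.one_le_cosh D
  have hDρ : Real.cosh D < Real.cosh ρ := by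
    rw [Real.cosh_lt_cosh, abs_of_pos hD0, abs_of_pos hρ]; exact h₂
  have hrD : Real.cosh r < Real.cosh D := by
    rw [Real.cosh_lt_cosh, abs_of_pos hr, abs_of_pos hD0]; exact h₁
  have hsub : truncatedCone T e r D ⊆ hclosedBall T ρ := fun p hp => by
    have h := truncatedCone_subset hr h₁ hp
    rw [mem_hclosedBall_iff _ _ hω0.le, hω] at h
    rw [mem_hclosedBall_iff _ _ hρ.le]
    exact h.trans ((div_le_self (by linarith) hc1).trans hDρ.le)
  have hsplit : hconvexHull ({T} ∪ hclosedBall Q r) ∩ hclosedBall T ρ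
      = (hclosedBall Q r ∩ hclosedBall T ρ) ∪ truncatedCone T e r D := by
    ext p
    rw [Set.mem_inter_iff, mem_hconvexHull_iff_cone hTe hQ hr h₁]
    constructor
    · rintro ⟨h | h, hN⟩
      · exact Or.inl ⟨h, hN⟩
      · exact Or.inr h
    · rintro (h | h)
      · exact ⟨Or.inl h.1, h.2⟩
      · exact ⟨Or.inr h, hsub h⟩
  have hinter : hclosedBall Q r ∩ hclosedBall T ρ ∩ truncatedCone T e r D
      = hclosedBall Q r ∩ truncatedCone T e r D := by
    rw [Set.inter_assoc, Set.inter_eq_right.2 hsub]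
  have key := MeasureTheory.measureReal_union_add_inter (μ := hvol)
    (s := hclosedBall Q r ∩ hclosedBall T ρ) (measurableSet_truncatedCone (T := T) (e := e) r D)
    (measure_ne_top_of_subset Set.inter_subset_left (hvol_hclosedBall_ne_top Q hr.le))
    (measure_ne_top_of_subset hsub (hvol_hclosedBall_ne_top T hρ.le))
  have hn : lorentz (-axisNormal T e (psi (omega r D) (theta r D)))
      (-axisNormal T e (psi (omega r D) (theta r D))) = 1 := by
    rw [lorentz_neg_left, lorentz_neg_right, axisNormal_self he hTe, neg_neg]
  rw [hinter, hclosedBall_inter_truncatedCone hQ hr h₁,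
    hvol_hclosedBall_inter_halfSpace Q hr.le hn (neg_axisNormal_center he hTe hQ _),
    hvol_lens he hTe hQ hr hD0 hρ hη (by nlinarith),
    hvol_truncatedCone he hTe hr h₁, ← hsplit] at key
  change hvol.real _ = _
  rw [phi]
  linarith
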